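/- Let $R=\bigoplus_{n\in\mathbb Z}R_n$ be a commutative Noetherian $\mathbb Z$-graded ring and let $I,J$ be homogeneous ideals of $R$. For an $R$-module $M$ put $\Gamma_{I,J}(M)=\{x\in M: I^nx\subseteq Jx \text{ for all } n\gg 0\}$ and $\Gamma_{\mathfrak a}=\Gamma_{\mathfrak a,0}$ for an ideal $\mathfrak a$. Let ${}^*\mathcal C$ be the abelian category of $\mathbb Z$-graded $R$-modules and degree-preserving $R$-linear maps; it has enough injectives. If $M$ is a graded $R$-module, then $\Gamma_{I,J}(M)$ is a graded submodule of $M$. Hence $\Gamma_{I,J}$ is an additive functor ${}^*\mathcal C\to{}^*\mathcal C$. Denote by ${}^*H^i_{I,J}$ its right derived functors on ${}^*\mathcal C$ and put ${}^*H^i_{\mathfrak a}={}^*H^i_{\mathfrak a,0}$ for a homogeneous ideal $\mathfrak a$. These are equipped with their usual connecting homomorphisms. Let $${}^*\widetilde W(I,J)=\{\mathfrak a : \mathfrak a \text{ a homogeneous ideal of } R,\ I^n\subseteq\mathfrak a+J \text{ for some } n\ge 1\},$$ ordered by $\mathfrak a\le\mathfrak b$ if $\mathfrak a\supseteq\mathfrak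 b$; for $\mathfrak a\le\mathfrak b$ the inclusion $\Gamma_{\mathfrak a}\subseteq\Gamma_{\mathfrak b}$ induces morphisms ${}^*H^i_{\mathfrak a}\to{}^*H^i_{\mathfrak b}$ which commute with the connecting homomorphisms. Then $\big({}^*H^i_{I,J}\big)_{i\ge 0}$ and $\big(\varinjlim_{\mathfrak a\in{}^*\widetilde W(I,J)}{}^*H^i_{\mathfrak a}\big)_{i\ge 0}$ are strongly connected sequences of functors from ${}^*\mathcal C$ to itself (that is, they have connecting homomorphisms which are natural in short exact sequences and which give long exact sequences starting with $0\to T^0(L)\to T^0(M)\to T^0(N)\to T^1(L)\to\cdots$), and they are isomorphic as such: there are isomorphisms of graded modules $${}^*H^i_{I,J}(M)\;\cong\;\varinjlim_{\mathfrak a\in{}^*\widetilde W(I,J)}{}^*H^i_{\mathfrak a}(M)\qquad(i\ge 0),$$ natural in the graded module $M$, which commute with the connecting homomorphisms. -/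

import Mathlib

open CategoryTheory CategoryTheory.Limits

universe u

namespace GradedLC

section Torsion

variable {R : Type u} [CommRing R]

theorem smul_span_le_iff {M : Type u} [AddCommGroup M] [Module R M] (I J : Ideal R) (x : M) :
    I • Submodule.span R {x} ≤ J • Submodule.span R {x} ↔
      I ≤ Ideal.torsionOf R M x ⊔ J := by
  constructor
  · intro h a ha
    have h1 : a • x ∈ J • Submodule.span R {x} :=
      h (Submodule.smul_mem_smul ha (Submodule.mem_span_singleton_self x))
    rw [Submodule.mem_smul_span_singleton] at h1
    obtain ⟨b, hb, hbx⟩ := h1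
    rw [Submodule.mem_sup]
    refine ⟨a - b, ?_, b, hb, by ring⟩
    rw [Ideal.mem_torsionOf_iff, sub_smul, hbx, sub_self]
  · intro h y hy
    rw [Submodule.mem_smul_span_singleton] at hy ⊢
    obtain ⟨a, ha, rfl⟩ := hy
    obtain ⟨c, hc, b, hb, rfl⟩ := Submodule.mem_sup.1 (h ha)
    rw [Ideal.mem_torsionOf_iff] at hc
    exact ⟨b, hb, by rw [add_smul, hc, zero_add]⟩

theorem pow_le_torsionOf_iff {M : Type u} [AddCommGroup M] [Module R M] (I J : Ideal R) (x : M) :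
    (∃ N : ℕ, ∀ n ≥ N, I ^ n • Submodule.span R {x} ≤ J • Submodule.span R {x}) ↔
      ∃ n : ℕ, I ^ n ≤ Ideal.torsionOf R M x ⊔ J := by
  simp only [smul_span_le_iff]
  constructor
  · rintro ⟨N, h⟩
    exact ⟨N, h N le_rfl⟩
  · rintro ⟨N, h⟩
    exact ⟨N, fun n hn => (Ideal.pow_le_pow_right hn).trans h⟩

/-- The `(I,J)`-torsion submodule
`Γ_{I,J}(M) = {x ∈ M : Iⁿ x ⊆ J x for all large n}`. -/
def torsion (I J : Ideal R) (M : Type u) [AddCommGroup M] [Module R M] : Submodule R M where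
  carrier := {x | ∃ N : ℕ, ∀ n ≥ N, I ^ n • Submodule.span R {x} ≤ J • Submodule.span R {x}}
  zero_mem' := ⟨0, fun n _ => by simp⟩
  add_mem' := by
    intro x y hx hy
    rw [Set.mem_ofPred_eq, pow_le_torsionOf_iff] at hx hy ⊢
    obtain ⟨n, hn⟩ := hx
    obtain ⟨m, hm⟩ := hy
    refine ⟨n + m, ?_⟩
    rw [pow_add]
    refine (Ideal.mul_mono hn hm).trans ?_
    rw [Ideal.mul_le]
    intro r hr s hs
    obtain ⟨a, ha, b, hb, rfl⟩ := Submodule.mem_sup.1 hr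
    obtain ⟨c, hc, d, hd, rfl⟩ := Submodule.mem_sup.1 hs
    rw [Ideal.mem_torsionOf_iff] at ha hc
    refine Submodule.mem_sup.2 ⟨a * c, ?_, a * d + b * (c + d), ?_, by ring⟩
    · rw [Ideal.mem_torsionOf_iff, smul_add, mul_smul a c y, hc, smul_zero, mul_comm, mul_smul, ha,
        smul_zero, add_zero]
    · exact J.add_mem (J.mul_mem_left _ hd) (J.mul_mem_right _ hb)
  smul_mem' := by
    intro r x hx
    rw [Set.mem_ofPred_eq, pow_le_torsionOf_iff] at hx ⊢
    obtain ⟨n, hn⟩ := hx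
    refine ⟨n, hn.trans (sup_le_sup_right ?_ _)⟩
    intro a ha
    rw [Ideal.mem_torsionOf_iff] at ha ⊢
    rw [smul_comm, ha, smul_zero]

theorem mem_torsion_iff (I J : Ideal R) {M : Type u} [AddCommGroup M] [Module R M] (x : M) :
    x ∈ torsion I J M ↔ ∃ n : ℕ, I ^ n ≤ Ideal.torsionOf R M x ⊔ J :=
  pow_le_torsionOf_iff I J x

theorem map_mem_torsion (I J : Ideal R) {M N : Type u} [AddCommGroup M] [Module R M]
    [AddCommGroup N] [Module R N] (f : M →ₗ[R] N) {x : M} (hx : x ∈ torsion I J M) :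
    f x ∈ torsion I J N := by
  rw [mem_torsion_iff] at hx ⊢
  obtain ⟨n, hn⟩ := hx
  refine ⟨n, hn.trans (sup_le_sup_right ?_ _)⟩
  intro a ha
  rw [Ideal.mem_torsionOf_iff] at ha ⊢
  rw [← map_smul, ha, map_zero]

theorem torsion_mono {I I' J J' : Ideal R} (hI : I' ≤ I) (hJ : J ≤ J') (M : Type u)
    [AddCommGroup M] [Module R M] : torsion I J M ≤ torsion I' J' M := by
  intro x hx
  rw [mem_torsion_iff] at hx ⊢
  obtain ⟨n, hn⟩ := hx
  exact ⟨n, (Ideal.pow_right_mono hI n).trans (hn.trans (sup_le_sup_left hJ _))⟩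

/-- For `J = 0` this is the usual `I`-torsion submodule
`Γ_I(M) = {x ∈ M : Iⁿ x = 0 for some n}`. -/
theorem mem_torsion_bot_iff (I : Ideal R) {M : Type u} [AddCommGroup M] [Module R M] (x : M) :
    x ∈ torsion I ⊥ M ↔ ∃ n : ℕ, ∀ a ∈ I ^ n, a • x = 0 := by
  rw [mem_torsion_iff, sup_bot_eq]
  rfl

end Torsion

section GradedTorsion

variable {R : Type u} [CommRing R]
variable {M : Type u} [AddCommGroup M] (ℳ : ℤ → AddSubgroup M)
  [DirectSum.Decomposition ℳ]

/-- The projection of a graded module onto its component of degree `n`. -/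
noncomputable def proj (n : ℤ) : M →+ M where
  toFun x := (DirectSum.decompose ℳ x n : M)
  map_zero' := by simp
  map_add' := by simp

theorem proj_mem (n : ℤ) (x : M) : proj ℳ n x ∈ ℳ n := (DirectSum.decompose ℳ x n).2

theorem proj_same {n : ℤ} {x : M} (hx : x ∈ ℳ n) : proj ℳ n x = x :=
  DirectSum.decompose_of_mem_same ℳ hx

theorem proj_ne {m n : ℤ} {x : M} (hx : x ∈ ℳ m) (h : m ≠ n) : proj ℳ n x = 0 :=
  DirectSum.decompose_of_mem_ne ℳ hx h

theorem exists_sum_proj (x : M) : ∃ s : Finset ℤ, ∑ n ∈ s, proj ℳ n x = x := by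
  classical
  exact ⟨_, DirectSum.sum_support_decompose ℳ x⟩

theorem exists_finset_proj (x : M) : ∃ s : Finset ℤ, ∀ n ∉ s, proj ℳ n x = 0 := by
  classical
  refine ⟨(DirectSum.decompose ℳ x).support, fun n hn => ?_⟩
  rw [DFinsupp.notMem_support_iff] at hn
  change ((DirectSum.decompose ℳ x n : ℳ n) : M) = 0
  rw [hn]; rfl

theorem sum_proj_of_subset {x : M} {s : Finset ℤ} (h : ∀ n ∉ s, proj ℳ n x = 0) :
    ∑ n ∈ s, proj ℳ n x = x := by
  classical
  conv_rhs => rw [← DirectSum.sum_support_decompose ℳ x]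
  symm
  apply Finset.sum_subset
  · intro n hn
    by_contra hs
    rw [DFinsupp.mem_support_iff] at hn
    exact hn (Subtype.ext (h n hs))
  · intro n _ hn
    rw [DFinsupp.notMem_support_iff] at hn
    change ((DirectSum.decompose ℳ x n : ℳ n) : M) = 0
    rw [hn]; rfl

theorem eq_zero_of_proj {x : M} (h : ∀ n, proj ℳ n x = 0) : x = 0 := by
  rw [← sum_proj_of_subset ℳ (s := ∅) (fun n _ => h n), Finset.sum_empty]

theorem proj_smul_of_mem (𝒜 : ℤ → AddSubgroup R) [Module R M] [SetLike.GradedSMul 𝒜 ℳ] {k : ℤ} {a : R} (ha : a ∈ 𝒜 k) (x : M) (n : ℤ) :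
    proj ℳ n (a • x) = a • proj ℳ (n - k) x := by
  classical
  obtain ⟨s, hs⟩ := exists_finset_proj ℳ x
  have h : ∀ m, proj ℳ n (a • proj ℳ m x) = if m = n - k then a • proj ℳ m x else 0 := by
    intro m
    have hm : a • proj ℳ m x ∈ ℳ (k + m) := SetLike.GradedSMul.smul_mem ha (proj_mem ℳ m x)
    split_ifs with h
    · subst h
      rw [show k + (n - k) = n by ring] at hm
      exact proj_same ℳ hm
    · exact proj_ne ℳ hm (by omega)
  conv_lhs => rw [← sum_proj_of_subset ℳ hs, Finset.smul_sum, map_sum]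
  simp only [h]
  rw [Finset.sum_ite_eq']
  split_ifs with h'
  · rfl
  · rw [hs _ h', smul_zero]

/-- If all components of `z` in degrees below `l` vanish and `z` kills `x`, then the component of
`z` of degree `l` is nilpotent on all components of `x`. -/
theorem exists_pow_proj_smul_eq_zero (𝒜 : ℤ → AddSubgroup R) [GradedRing 𝒜] [Module R M]
    [SetLike.GradedSMul 𝒜 ℳ] {z : R} {l : ℤ} (hz : ∀ k < l, proj 𝒜 k z = 0) {x : M}
    (hx : z • x = 0) (n : ℤ) : ∃ t : ℕ, (proj 𝒜 l z) ^ t • proj ℳ n x = 0 := by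
  classical
  obtain ⟨s, hs⟩ := exists_finset_proj ℳ x
  obtain ⟨b, hb⟩ : ∃ b : ℤ, ∀ m < b, proj ℳ m x = 0 := by
    obtain ⟨b, hb⟩ := s.bddBelow
    exact ⟨b, fun m hm => hs m fun hms => absurd (hb hms) (by omega)⟩
  have key : ∀ d : ℕ, ∃ t : ℕ, ∀ m < b + d, (proj 𝒜 l z) ^ t • proj ℳ m x = 0 := by
    intro d
    induction d with
    | zero => exact ⟨0, fun m hm => by rw [hb m (by simpa using hm), smul_zero]⟩
    | succ d ih =>
      obtain ⟨t, ht⟩ := ih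
      refine ⟨t + 1, fun m hm => ?_⟩
      rcases lt_or_ge m (b + d) with h | h
      · rw [pow_succ', mul_smul, ht m h, smul_zero]
      · have hmd : m = b + d := by push_cast at hm; omega
        obtain ⟨s', hs'⟩ := exists_finset_proj 𝒜 z
        have h0 : proj ℳ (l + m) (z • x) = 0 := by rw [hx, map_zero]
        rw [← sum_proj_of_subset 𝒜 (s := insert l s') (x := z)
          (fun k hk => hs' k fun h => hk (Finset.mem_insert_of_mem h)), Finset.sum_smul,
          map_sum] at h0
        simp only [proj_smul_of_mem ℳ 𝒜 (proj_mem 𝒜 _ z)] at h0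
        have h1 := congrArg (fun w => (proj 𝒜 l z) ^ t • w) h0
        simp only [smul_zero, Finset.smul_sum] at h1
        rw [Finset.sum_eq_single l] at h1
        · rw [← mul_smul, ← pow_succ, add_sub_cancel_left] at h1
          exact h1
        · intro k _ hk
          rcases lt_or_gt_of_ne hk with hlt | hgt
          · rw [hz k hlt, zero_smul, smul_zero]
          · rw [smul_comm, ht _ (by omega), smul_zero]
        · intro hl
          exact absurd (Finset.mem_insert_self l s') hl
  obtain ⟨t, ht⟩ := key (n - b + 1).toNat
  exact ⟨t, ht n (by omega)⟩

theorem proj_mul_of_lower (𝒜 : ℤ → AddSubgroup R) [GradedRing 𝒜] {y z : R} {k l : ℤ} (hy : ∀ i < k, proj 𝒜 i y = 0)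
    (hz : ∀ i < l, proj 𝒜 i z = 0) :
    (∀ i < k + l, proj 𝒜 i (y * z) = 0) ∧
      proj 𝒜 (k + l) (y * z) = proj 𝒜 k y * proj 𝒜 l z := by
  classical
  obtain ⟨s, hs⟩ := exists_finset_proj 𝒜 y
  have h (i : ℤ) : proj 𝒜 i (y * z) =
      ∑ j ∈ insert k s, proj 𝒜 j y * proj 𝒜 (i - j) z := by
    conv_lhs => rw [← sum_proj_of_subset 𝒜 (s := insert k s) (x := y)
          (fun k' hk => hs k' fun h => hk (Finset.mem_insert_of_mem h)), Finset.sum_mul, map_sum]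
    refine Finset.sum_congr rfl fun j _ => ?_
    rw [← smul_eq_mul, proj_smul_of_mem 𝒜 𝒜 (proj_mem 𝒜 _ y), smul_eq_mul]
  constructor
  · intro i hi
    rw [h]
    refine Finset.sum_eq_zero fun j _ => ?_
    rcases lt_or_ge j k with hj | hj
    · rw [hy j hj, zero_mul]
    · rw [hz _ (by omega), mul_zero]
  · rw [h, Finset.sum_eq_single k]
    · rw [add_sub_cancel_left]
    · intro j _ hj
      rcases lt_or_gt_of_ne hj with hj | hj
      · rw [hy j hj, zero_mul]
      · rw [hz _ (by omega), mul_zero]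
    · intro hl
      exact absurd (Finset.mem_insert_self k s) hl

theorem proj_pow_of_lower (𝒜 : ℤ → AddSubgroup R) [GradedRing 𝒜] {y : R} {k : ℤ} (hy : ∀ i < k, proj 𝒜 i y = 0) (s : ℕ) :
    (∀ i < s * k, proj 𝒜 i (y ^ s) = 0) ∧ proj 𝒜 (s * k) (y ^ s) = (proj 𝒜 k y) ^ s := by
  induction s with
  | zero =>
    have h1 : (1 : R) ∈ 𝒜 0 := SetLike.GradedOne.one_mem
    simp only [pow_zero, Nat.cast_zero, zero_mul]
    exact ⟨fun i hi => proj_ne 𝒜 h1 (by omega), proj_same 𝒜 h1⟩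
  | succ s ih =>
    have := proj_mul_of_lower 𝒜 ih.1 hy
    rw [ih.2] at this
    rw [pow_succ, pow_succ, show ((s + 1 : ℕ) : ℤ) * k = s * k + k by push_cast; ring]
    exact this

/-- The radical of the annihilator of `x` annihilates, up to powers, every component of `x`. -/
theorem torsionOf_le_radical_proj (𝒜 : ℤ → AddSubgroup R) [GradedRing 𝒜] [Module R M]
    [SetLike.GradedSMul 𝒜 ℳ] (x : M) (n : ℤ) :
    (Ideal.torsionOf R M x).radical ≤ (Ideal.torsionOf R M (proj ℳ n x)).radical := by
  classical
  have key : ∀ c : ℕ, ∀ s : Finset ℤ, s.card ≤ c → ∀ y : R, (∀ k ∉ s, proj 𝒜 k y = 0) →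
      y ∈ (Ideal.torsionOf R M x).radical →
      ∀ n, y ∈ (Ideal.torsionOf R M (proj ℳ n x)).radical := by
    intro c
    induction c with
    | zero =>
      intro s hs y hy _ n
      have : y = 0 := eq_zero_of_proj 𝒜 fun k => hy k (by simp_all)
      rw [this]
      exact zero_mem _
    | succ c ih =>
      intro s hs y hy hyx
      rcases s.eq_empty_or_nonempty with h | h
      · intro n
        have : y = 0 := eq_zero_of_proj 𝒜 fun k => hy k (by simp_all)
        rw [this]
        exact zero_mem _
      · set k := s.min' h with hk
        have hlow : ∀ i < k, proj 𝒜 i y = 0 := fun i hi => hy i fun his =>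
          absurd (s.min'_le i his) (by omega)
        have ha : ∀ n, proj 𝒜 k y ∈ (Ideal.torsionOf R M (proj ℳ n x)).radical := by
          intro n
          obtain ⟨p, hp⟩ := hyx
          rw [Ideal.mem_torsionOf_iff] at hp
          obtain ⟨h1, h2⟩ := proj_pow_of_lower 𝒜 hlow p
          obtain ⟨t, ht⟩ := exists_pow_proj_smul_eq_zero ℳ 𝒜 h1 hp n
          rw [h2, ← pow_mul] at ht
          exact ⟨p * t, by rwa [Ideal.mem_torsionOf_iff]⟩
        have ha' : proj 𝒜 k y ∈ (Ideal.torsionOf R M x).radical := by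
          obtain ⟨s', hs'⟩ := exists_finset_proj ℳ x
          choose t ht using ha
          refine ⟨∑ n ∈ s', t n, ?_⟩
          rw [Ideal.mem_torsionOf_iff]
          conv_lhs => rw [← sum_proj_of_subset ℳ hs', Finset.smul_sum]
          refine Finset.sum_eq_zero fun m hm => ?_
          have := ht m
          rw [Ideal.mem_torsionOf_iff] at this
          rw [← Finset.sum_erase_add _ _ hm, pow_add, mul_smul, this, smul_zero]
        intro n
        have hsub : y - proj 𝒜 k y ∈ (Ideal.torsionOf R M (proj ℳ n x)).radical := by
          refine ih (s.erase k) ?_ _ ?_ (sub_mem hyx ha') n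
          · rw [Finset.card_erase_of_mem (s.min'_mem h)]
            omega
          · intro i hi
            rw [map_sub]
            by_cases hik : i = k
            · subst hik
              rw [proj_same 𝒜 (proj_mem 𝒜 _ y), sub_self]
            · rw [proj_ne 𝒜 (proj_mem 𝒜 k y) (Ne.symm hik), sub_zero]
              exact hy i fun h' => hi (Finset.mem_erase.2 ⟨hik, h'⟩)
        have := add_mem hsub (ha n)
        rwa [sub_add_cancel] at this
  intro y hy
  obtain ⟨s, hs⟩ := exists_finset_proj 𝒜 y
  exact key s.card s le_rfl y hs hy n

theorem sup_pow_le (A J : Ideal R) (n : ℕ) : (A ⊔ J) ^ n ≤ A ^ n ⊔ J := by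
  induction n with
  | zero => simp
  | succ n ih =>
    rw [pow_succ, pow_succ]
    refine (Ideal.mul_mono_left ih).trans ?_
    rw [Ideal.sup_mul]
    refine sup_le ?_ ((Ideal.mul_le_inf.trans inf_le_left : J * (A ⊔ J) ≤ J).trans le_sup_right)
    rw [Ideal.mul_sup]
    exact sup_le le_sup_left ((Ideal.mul_le_inf.trans inf_le_right : A ^ n * J ≤ J).trans le_sup_right)

/-- Over a Noetherian graded ring, the `(I,J)`-torsion submodule of a graded module contains the
homogeneous components of its elements. -/
theorem proj_mem_torsion (𝒜 : ℤ → AddSubgroup R) [GradedRing 𝒜] [Module R M]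
    [SetLike.GradedSMul 𝒜 ℳ] [IsNoetherianRing R] (I J : Ideal R) {x : M} (hx : x ∈ torsion I J M)
    (n : ℤ) : proj ℳ n x ∈ torsion I J M := by
  rw [mem_torsion_iff] at hx ⊢
  obtain ⟨p, hp⟩ := hx
  obtain ⟨t, ht⟩ := Ideal.exists_radical_pow_le_of_fg (Ideal.torsionOf R M (proj ℳ n x))
    (IsNoetherian.noetherian _)
  refine ⟨p * (t + 1), ?_⟩
  rw [pow_mul]
  refine (Ideal.pow_right_mono hp _).trans ((sup_pow_le _ _ _).trans (sup_le_sup_right ?_ _))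
  refine (Ideal.pow_right_mono (Ideal.le_radical.trans
    (torsionOf_le_radical_proj ℳ 𝒜 x n)) _).trans ?_
  exact (Ideal.pow_le_pow_right (Nat.le_succ t)).trans ht

end GradedTorsion

section Category

/-- A decomposition from a family of projections. -/
theorem isInternal_of_proj {M : Type u} [AddCommGroup M] (ℳ : ℤ → AddSubgroup M)
    (p : ℤ → M →+ M) (h1 : ∀ n x, x ∈ ℳ n → p n x = x)
    (h2 : ∀ n m x, x ∈ ℳ m → m ≠ n → p n x = 0) (h3 : ∀ x, x ∈ ⨆ n, ℳ n) :
    DirectSum.IsInternal ℳ := by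
  classical
  constructor
  · rw [injective_iff_map_eq_zero]
    intro x hx
    have key : ∀ (y : DirectSum ℤ fun n => ℳ n) (n : ℤ),
        p n (DirectSum.coeAddMonoidHom ℳ y) = y n := by
      intro y n
      induction y using DirectSum.induction_on with
      | zero => simp
      | of i y =>
        rw [DirectSum.coeAddMonoidHom_of]
        by_cases h : i = n
        · subst h
          rw [h1 _ _ y.2, DirectSum.of_eq_same]
        · rw [h2 _ _ _ y.2 h, DirectSum.of_eq_of_ne _ _ _ (Ne.symm h)]
          rfl
      | add y z hy hz => rw [map_add, map_add, hy, hz]; rfl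
    refine DFinsupp.ext fun n => Subtype.ext ?_
    have := key x n
    rw [hx, map_zero] at this
    exact this.symm
  · intro x
    have hle : ⨆ n, ℳ n ≤ (DirectSum.coeAddMonoidHom ℳ).range :=
      iSup_le fun n x hx => ⟨DirectSum.of _ n ⟨x, hx⟩, DirectSum.coeAddMonoidHom_of ℳ n ⟨x, hx⟩⟩
    exact hle (h3 x)

variable {R : Type u} [CommRing R] (𝒜 : ℤ → AddSubgroup R)

/-- A graded module `M = ⨁ₙ Mₙ` over the graded ring `R = ⨁ₙ 𝒜 n`. -/
structure GrMod where
  /-- the underlying module -/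
  carrier : Type u
  [addCommGroup : AddCommGroup carrier]
  [module : Module R carrier]
  /-- the homogeneous components -/
  deg : ℤ → AddSubgroup carrier
  [decomposition : DirectSum.Decomposition deg]
  [gradedSMul : SetLike.GradedSMul 𝒜 deg]

namespace GrMod

attribute [instance] addCommGroup module decomposition gradedSMul

variable {𝒜}

/-- A homogeneous homomorphism: an `R`-linear map which preserves degrees. -/
@[ext]
structure Hom (M N : GrMod 𝒜) where
  /-- the underlying linear map -/
  lin : M.carrier →ₗ[R] N.carrier
  map_deg : ∀ (n : ℤ) (x : M.carrier), x ∈ M.deg n → lin x ∈ N.deg n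

instance : Category (GrMod 𝒜) where
  Hom := Hom
  id M := ⟨LinearMap.id, fun _ _ h => h⟩
  comp f g := ⟨g.lin.comp f.lin, fun n x h => g.map_deg n _ (f.map_deg n x h)⟩

@[ext]
theorem hom_ext {M N : GrMod 𝒜} {f g : M ⟶ N} (h : ∀ x, f.lin x = g.lin x) : f = g :=
  Hom.ext (LinearMap.ext h)

@[simp] theorem id_lin (M : GrMod 𝒜) : Hom.lin (𝟙 M) = LinearMap.id := rfl

@[simp] theorem comp_lin {M N P : GrMod 𝒜} (f : M ⟶ N) (g : N ⟶ P) :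
    (f ≫ g).lin = g.lin.comp f.lin := rfl

variable {M N : GrMod 𝒜}

instance : Zero (M ⟶ N) := ⟨⟨0, fun n _ _ => (N.deg n).zero_mem⟩⟩
instance : Add (M ⟶ N) :=
  ⟨fun f g => ⟨f.lin + g.lin, fun n x h => (N.deg n).add_mem (f.map_deg n x h) (g.map_deg n x h)⟩⟩
instance : Neg (M ⟶ N) :=
  ⟨fun f => ⟨-f.lin, fun n x h => (N.deg n).neg_mem (f.map_deg n x h)⟩⟩

@[simp] theorem zero_lin : Hom.lin (0 : M ⟶ N) = 0 := rfl
@[simp] theorem add_lin (f g : M ⟶ N) : (f + g).lin = f.lin + g.lin := rfl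
@[simp] theorem neg_lin (f : M ⟶ N) : (-f).lin = -f.lin := rfl

instance : AddCommGroup (M ⟶ N) where
  add_assoc f g h := by ext; simp [add_assoc]
  zero_add f := by ext; simp
  add_zero f := by ext; simp
  add_comm f g := by ext; simp [add_comm]
  neg_add_cancel f := by ext; simp
  nsmul := nsmulRec
  zsmul := zsmulRec

instance : Preadditive (GrMod 𝒜) where
  add_comp _ _ _ f g h := by ext; simp
  comp_add _ _ _ f g h := by ext; simp

theorem lin_proj (f : M ⟶ N) (n : ℤ) (x : M.carrier) :
    f.lin (proj M.deg n x) = proj N.deg n (f.lin x) := by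
  obtain ⟨s, hs⟩ := exists_finset_proj M.deg x
  conv_rhs => rw [← sum_proj_of_subset M.deg (s := insert n s) (x := x)
    (fun k hk => hs k fun h => hk (Finset.mem_insert_of_mem h)), map_sum, map_sum]
  rw [Finset.sum_eq_single n]
  · rw [proj_same N.deg (f.map_deg _ _ (proj_mem M.deg n x))]
  · intro m _ hm
    exact proj_ne N.deg (f.map_deg _ _ (proj_mem M.deg m x)) hm
  · intro h
    exact absurd (Finset.mem_insert_self n s) h

theorem mem_deg_iff (n : ℤ) (x : M.carrier) : x ∈ M.deg n ↔ proj M.deg n x = x :=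
  ⟨fun h => proj_same M.deg h, fun h => h ▸ proj_mem M.deg n x⟩

/-- A graded submodule, as a graded module. -/
noncomputable def sub (M : GrMod 𝒜) (p : Submodule R M.carrier)
    (hp : ∀ (n : ℤ) (x : M.carrier), x ∈ p → proj M.deg n x ∈ p) : GrMod 𝒜 where
  carrier := p
  deg n := (M.deg n).comap p.subtype.toAddMonoidHom
  decomposition := by
    refine DirectSum.IsInternal.chooseDecomposition _ (isInternal_of_proj _
      (fun n => ((proj M.deg n).comp p.subtype.toAddMonoidHom).codRestrict p
        fun x => hp n x x.2) ?_ ?_ ?_)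
    · intro n x hx
      exact Subtype.ext (proj_same M.deg hx)
    · intro n m x hx h
      exact Subtype.ext (proj_ne M.deg hx h)
    · intro x
      obtain ⟨s, hs⟩ := exists_sum_proj M.deg (x : M.carrier)
      have : x = ∑ n ∈ s, (⟨proj M.deg n x, hp n x x.2⟩ : p) := Subtype.ext (by
        rw [AddSubmonoidClass.coe_finsetSum]; exact hs.symm)
      rw [this]
      exact sum_mem fun n _ => AddSubgroup.mem_iSup_of_mem n (proj_mem M.deg n x)
  gradedSMul := ⟨fun {_ _ _ _} ha hx => SetLike.GradedSMul.smul_mem (B := M.deg) ha hx⟩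

/-- The quotient by a graded submodule, as a graded module. -/
noncomputable def quot (M : GrMod 𝒜) (p : Submodule R M.carrier)
    (hp : ∀ (n : ℤ) (x : M.carrier), x ∈ p → proj M.deg n x ∈ p) : GrMod 𝒜 where
  carrier := M.carrier ⧸ p
  deg n := (M.deg n).map p.mkQ.toAddMonoidHom
  decomposition := by
    refine DirectSum.IsInternal.chooseDecomposition _ (isInternal_of_proj _
      (fun n => QuotientAddGroup.map p.toAddSubgroup p.toAddSubgroup (proj M.deg n)
        fun x hx => hp n x hx) ?_ ?_ ?_)
    · rintro n _ ⟨x, hx, rfl⟩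
      exact congrArg p.mkQ (proj_same M.deg hx)
    · rintro n m _ ⟨x, hx, rfl⟩ h
      exact (congrArg p.mkQ (proj_ne M.deg hx h)).trans (map_zero _)
    · intro x
      obtain ⟨x, rfl⟩ := p.mkQ_surjective x
      obtain ⟨s, hs⟩ := exists_sum_proj M.deg x
      rw [← hs, map_sum]
      exact sum_mem fun n _ => AddSubgroup.mem_iSup_of_mem n ⟨_, proj_mem M.deg n x, rfl⟩
  gradedSMul := ⟨by
    rintro i j a _ ha ⟨x, hx, rfl⟩
    exact ⟨a • x, SetLike.GradedSMul.smul_mem ha hx, rfl⟩⟩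

/-- The direct sum of a family of graded modules. -/
noncomputable def sum {ι : Type u} (M : ι → GrMod 𝒜) : GrMod 𝒜 where
  carrier := DirectSum ι fun i => (M i).carrier
  deg n :=
    { carrier := {x | ∀ i, x i ∈ (M i).deg n}
      zero_mem' := fun i => zero_mem _
      add_mem' := fun hx hy i => add_mem (hx i) (hy i)
      neg_mem' := fun hx i => neg_mem (hx i) }
  decomposition := by
    classical
    refine DirectSum.IsInternal.chooseDecomposition _ (isInternal_of_proj _
      (fun n => DirectSum.map fun i => proj (M i).deg n) ?_ ?_ ?_)
    · intro n x hx
      exact DFinsupp.ext fun i => (DirectSum.map_apply ..).trans (proj_same (M i).deg (hx i))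
    · intro n m x hx h
      exact DFinsupp.ext fun i => (DirectSum.map_apply ..).trans (proj_ne (M i).deg (hx i) h)
    · intro x
      induction x using DirectSum.induction_on with
      | zero => exact zero_mem _
      | of i x =>
        obtain ⟨s, hs⟩ := exists_sum_proj (M i).deg x
        rw [← hs, map_sum]
        refine sum_mem fun n _ => AddSubgroup.mem_iSup_of_mem n fun j => ?_
        by_cases h : i = j
        · subst h
          rw [DirectSum.of_eq_same]
          exact proj_mem _ _ _
        · rw [DirectSum.of_eq_of_ne _ _ _ (Ne.symm h)]
          exact zero_mem _
      | add x y hx hy => exact add_mem hx hy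
  gradedSMul := ⟨fun {_ _ _ _} ha hx i => SetLike.GradedSMul.smul_mem (B := (M i).deg) ha (hx i)⟩

section Sum

variable {ι : Type u} (L : ι → GrMod 𝒜)

open Classical in
/-- The inclusion of a summand. -/
noncomputable def sumInj (i : ι) : L i ⟶ sum L where
  lin := DirectSum.lof R ι (fun i => (L i).carrier) i
  map_deg n x hx j := by
    change DirectSum.of (fun i => (L i).carrier) i x j ∈ _
    by_cases h : i = j
    · subst h
      rw [DirectSum.of_eq_same]
      exact hx
    · rw [DirectSum.of_eq_of_ne _ _ _ (Ne.symm h)]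
      exact zero_mem _

open Classical in
/-- The morphism out of a direct sum with given restrictions. -/
noncomputable def sumDesc {P : GrMod 𝒜} (f : ∀ i, L i ⟶ P) : sum L ⟶ P where
  lin := DirectSum.toModule R ι P.carrier fun i => (f i).lin
  map_deg n x hx := by
    have key : ∀ y : DirectSum ι fun i => (L i).carrier, (∀ i, y i ∈ (L i).deg n) →
        DirectSum.toModule R ι P.carrier (fun i => (f i).lin) y ∈ P.deg n := by
      intro y hy
      rw [← DirectSum.sum_support_of y, map_sum]
      refine sum_mem fun i _ => ?_
      have := DirectSum.toModule_lof R (φ := fun i => (f i).lin) i (y i)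
      exact this.symm ▸ (f i).map_deg n _ (hy i)
    exact key x hx

theorem sumInj_desc {P : GrMod 𝒜} (f : ∀ i, L i ⟶ P) (i : ι) :
    sumInj L i ≫ sumDesc L f = f i := by
  classical
  ext x
  exact DirectSum.toModule_lof R (φ := fun i => (f i).lin) i x

theorem sum_hom_ext {P : GrMod 𝒜} {f g : sum L ⟶ P} (h : ∀ i, sumInj L i ≫ f = sumInj L i ≫ g) :
    f = g := by
  classical
  refine Hom.ext (DirectSum.linearMap_ext R fun i => ?_)
  exact congrArg Hom.lin (h i)

end Sum

instance : HasCoproducts.{u} (GrMod 𝒜) :=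
  hasCoproducts_of_colimit_cofans (fun {_} L => Cofan.mk (sum L) (sumInj L)) fun {_} L =>
    Cofan.IsColimit.mk _ (fun s => sumDesc L s.inj) (fun s i => sumInj_desc L s.inj i)
      fun s _ hm => sum_hom_ext L fun i => (hm i).trans (sumInj_desc L s.inj i).symm

theorem proj_mem_ker (f : M ⟶ N) (n : ℤ) (x : M.carrier) (hx : x ∈ LinearMap.ker f.lin) :
    proj M.deg n x ∈ LinearMap.ker f.lin := by
  rw [LinearMap.mem_ker] at hx ⊢
  rw [lin_proj, hx, map_zero]

theorem proj_mem_range (f : M ⟶ N) (n : ℤ) (y : N.carrier) (hy : y ∈ LinearMap.range f.lin) :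
    proj N.deg n y ∈ LinearMap.range f.lin := by
  obtain ⟨x, rfl⟩ := hy
  exact ⟨proj M.deg n x, lin_proj f n x⟩

/-- The kernel of a homogeneous homomorphism. -/
noncomputable def kerObj (f : M ⟶ N) : GrMod 𝒜 := M.sub (LinearMap.ker f.lin) (proj_mem_ker f)

/-- The inclusion of the kernel. -/
noncomputable def kerι (f : M ⟶ N) : kerObj f ⟶ M :=
  ⟨(LinearMap.ker f.lin).subtype, fun _ _ h => h⟩

theorem kerι_comp (f : M ⟶ N) : kerι f ≫ f = 0 := by
  ext x
  exact x.2

/-- The cokernel of a homogeneous homomorphism. -/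
noncomputable def cokerObj (f : M ⟶ N) : GrMod 𝒜 :=
  N.quot (LinearMap.range f.lin) (proj_mem_range f)

/-- The projection to the cokernel. -/
noncomputable def cokerπ (f : M ⟶ N) : N ⟶ cokerObj f :=
  ⟨(LinearMap.range f.lin).mkQ, fun _ x h => ⟨x, h, rfl⟩⟩

theorem comp_cokerπ (f : M ⟶ N) : f ≫ cokerπ f = 0 := by
  ext x
  exact (Submodule.Quotient.mk_eq_zero _).2 ⟨x, rfl⟩

theorem comp_apply_eq_zero {P : GrMod 𝒜} {f : M ⟶ N} {g : N ⟶ P} (h : f ≫ g = 0) (x : M.carrier) :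
    g.lin (f.lin x) = 0 :=
  congrArg (fun k : M ⟶ P => k.lin x) h

/-- The universal property of the kernel. -/
noncomputable def isLimitKer (f : M ⟶ N) : IsLimit (KernelFork.ofι (kerι f) (kerι_comp f)) :=
  KernelFork.IsLimit.ofι _ _
    (fun g hg => ⟨g.lin.codRestrict _ fun x => comp_apply_eq_zero hg x, g.map_deg⟩)
    (fun g hg => rfl)
    (fun g hg m hm => by
      ext x
      exact Subtype.ext (congrArg (fun k => Hom.lin k x) hm))

/-- The universal property of the cokernel. -/
noncomputable def isColimitCoker (f : M ⟶ N) :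
    IsColimit (CokernelCofork.ofπ (cokerπ f) (comp_cokerπ f)) :=
  CokernelCofork.IsColimit.ofπ _ _
    (fun g hg => ⟨Submodule.liftQ _ g.lin (by
      rintro _ ⟨x, rfl⟩
      exact comp_apply_eq_zero hg x), by
      rintro n _ ⟨x, hx, rfl⟩
      exact g.map_deg n x hx⟩)
    (fun g hg => rfl)
    (fun g hg m hm => by
      ext x
      obtain ⟨x, rfl⟩ := Submodule.mkQ_surjective _ x
      exact congrArg (fun k => Hom.lin k x) hm)

instance : HasKernels (GrMod 𝒜) := ⟨fun f => ⟨⟨⟨_, isLimitKer f⟩⟩⟩⟩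

instance : HasCokernels (GrMod 𝒜) := ⟨fun f => ⟨⟨⟨_, isColimitCoker f⟩⟩⟩⟩

theorem injective_of_mono (f : M ⟶ N) [Mono f] : Function.Injective f.lin := by
  have h : kerι f = 0 := by
    rw [← cancel_mono f, kerι_comp, zero_comp]
  rw [← LinearMap.ker_eq_bot, eq_bot_iff]
  intro x hx
  exact congrArg (fun k => Hom.lin k (⟨x, hx⟩ : LinearMap.ker f.lin)) h

theorem surjective_of_epi (f : M ⟶ N) [Epi f] : Function.Surjective f.lin := by
  have h : cokerπ f = 0 := by
    rw [← cancel_epi f, comp_cokerπ, comp_zero]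
  intro y
  exact (Submodule.Quotient.mk_eq_zero _).1 (congrArg (fun k => Hom.lin k y) h)

theorem mono_of_injective (f : M ⟶ N) (hf : Function.Injective f.lin) : Mono f where
  right_cancellation g h e := by
    ext x
    exact hf (congrArg (fun k => Hom.lin k x) e)

theorem mem_deg_of_injective (f : M ⟶ N) (hf : Function.Injective f.lin) {n : ℤ} {x : M.carrier}
    (hx : f.lin x ∈ N.deg n) : x ∈ M.deg n := by
  rw [mem_deg_iff] at hx ⊢
  exact hf ((lin_proj f n x).trans hx)

/-- Every monomorphism is the kernel of its cokernel. -/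
theorem normalMono (f : M ⟶ N) [Mono f] : Nonempty (NormalMono f) := ⟨{
  Z := cokerObj f
  g := cokerπ f
  w := comp_cokerπ f
  isLimit := by
    have hf := injective_of_mono f
    have hmem : ∀ {W : GrMod 𝒜} (g : W ⟶ N), g ≫ cokerπ f = 0 → ∀ x, g.lin x ∈
        LinearMap.range f.lin := fun g hg x =>
      (Submodule.Quotient.mk_eq_zero _).1 (comp_apply_eq_zero hg x)
    have hfac : ∀ {W : GrMod 𝒜} (g : W ⟶ N) (hg : g ≫ cokerπ f = 0) (x : W.carrier),
        f.lin ((LinearEquiv.ofInjective f.lin hf).symm ⟨g.lin x, hmem g hg x⟩) = g.lin x :=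
      fun g hg x => congrArg Subtype.val
        ((LinearEquiv.ofInjective f.lin hf).apply_symm_apply ⟨g.lin x, hmem g hg x⟩)
    exact KernelFork.IsLimit.ofι _ _
      (fun g hg => ⟨(LinearEquiv.ofInjective f.lin hf).symm.toLinearMap.comp
        (g.lin.codRestrict _ (hmem g hg)), fun n x hx => mem_deg_of_injective f hf
          ((hfac g hg x).symm ▸ g.map_deg n x hx)⟩)
      (fun g hg => by
        ext x
        exact hfac g hg x)
      (fun g hg m hm => by
        rw [← cancel_mono f, hm]
        ext x
        exact (hfac g hg x).symm) }⟩

/-- Every epimorphism is the cokernel of its kernel. -/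
theorem normalEpi (f : M ⟶ N) [Epi f] : Nonempty (NormalEpi f) := ⟨{
  W := kerObj f
  g := kerι f
  w := kerι_comp f
  isColimit := by
    have hf := surjective_of_epi f
    have hle : ∀ {W : GrMod 𝒜} (g : M ⟶ W), kerι f ≫ g = 0 →
        LinearMap.ker f.lin ≤ LinearMap.ker g.lin := fun g hg x hx =>
      comp_apply_eq_zero hg ⟨x, hx⟩
    have hfac : ∀ {W : GrMod 𝒜} (g : M ⟶ W) (hg : kerι f ≫ g = 0) (x : M.carrier),
        Submodule.liftQ _ g.lin (hle g hg)
          ((f.lin.quotKerEquivOfSurjective hf).symm (f.lin x)) = g.lin x := by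
      intro W g hg x
      have : (f.lin.quotKerEquivOfSurjective hf).symm (f.lin x) = Submodule.Quotient.mk x := by
        rw [LinearEquiv.symm_apply_eq]
        rfl
      rw [this]
      rfl
    exact CokernelCofork.IsColimit.ofπ _ _
      (fun {W} g hg => ⟨(Submodule.liftQ _ g.lin (hle g hg)).comp
        (f.lin.quotKerEquivOfSurjective hf).symm.toLinearMap, fun n y hy => by
          obtain ⟨x, rfl⟩ := hf y
          have h1 : f.lin (proj M.deg n x) = f.lin x := by
            rw [lin_proj]
            exact proj_same N.deg hy
          rw [← h1]
          exact (hfac g hg (proj M.deg n x)).symm ▸ g.map_deg n _ (proj_mem M.deg n x)⟩)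
      (fun g hg => by
        ext x
        exact hfac g hg x)
      (fun g hg m hm => by
        rw [← cancel_epi f, hm]
        ext x
        exact (hfac g hg x).symm) }⟩

noncomputable instance : Abelian (GrMod 𝒜) :=
  have : HasFiniteCoproducts (GrMod 𝒜) := hasFiniteCoproducts_of_hasCoproducts.{u} _
  have : HasFiniteBiproducts (GrMod 𝒜) := HasFiniteBiproducts.of_hasFiniteCoproducts
  { normalMonoOfMono := fun f _ => normalMono f
    normalEpiOfEpi := fun f _ => normalEpi f
    has_finite_products := inferInstance }

instance : HasColimitsOfSize.{u, u} (GrMod 𝒜) := has_colimits_of_hasCoequalizers_and_coproducts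

theorem hom_ext_of_mem {f g : M ⟶ N} (h : ∀ n, ∀ x ∈ M.deg n, f.lin x = g.lin x) : f = g := by
  ext x
  obtain ⟨s, hs⟩ := exists_sum_proj M.deg x
  rw [← hs, map_sum, map_sum]
  exact Finset.sum_congr rfl fun n _ => h n _ (proj_mem M.deg n x)

section Cofree

/-- The direct sum of copies of `A` indexed by the integers. -/
def Cofree {R : Type u} [CommRing R] (_𝒜 : ℤ → AddSubgroup R) (A : Type u) [AddCommGroup A] : Type u := DirectSum ℤ fun _ => A

noncomputable instance (A : Type u) [AddCommGroup A] : AddCommGroup (Cofree 𝒜 A) :=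
  inferInstanceAs (AddCommGroup (DirectSum ℤ fun _ => A))

variable (𝒜) in
/-- The copy of `A` in degree `n`. -/
noncomputable def Cofree.of (A : Type u) [AddCommGroup A] (n : ℤ) : A →+ Cofree 𝒜 A :=
  DirectSum.of (fun _ : ℤ => A) n

theorem Cofree.induction {A : Type u} [AddCommGroup A] {P : Cofree 𝒜 A → Prop}
    (x : Cofree 𝒜 A) (zero : P 0) (of : ∀ n a, P (Cofree.of 𝒜 A n a))
    (add : ∀ x y, P x → P y → P (x + y)) : P x :=
  DirectSum.induction_on x zero of add

variable [GradedRing 𝒜]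

/-- The graded action of `R` on copies of `A`. -/
noncomputable abbrev cofreeGmodule (A : Type u) [AddCommGroup A] [Module R A] :
    DirectSum.Gmodule (fun i : ℤ => 𝒜 i) (fun _ : ℤ => A) where
  smul a x := (a : R) • x
  one_smul := fun ⟨i, x⟩ => Sigma.ext (zero_add i) (heq_of_eq (one_smul R x))
  mul_smul := fun ⟨i, a⟩ ⟨j, b⟩ ⟨k, x⟩ =>
    Sigma.ext (add_assoc i j k) (heq_of_eq (mul_smul (a : R) (b : R) x))
  smul_add a x y := smul_add (a : R) x y
  smul_zero a := smul_zero (a : R)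
  add_smul a b x := add_smul (a : R) (b : R) x
  zero_smul x := zero_smul R x

/-- The `R`-module structure on `⨁ₙ A` for which `a ∈ 𝒜 k` maps the copy in degree `n` to the copy
in degree `k + n`. -/
noncomputable instance (A : Type u) [AddCommGroup A] [Module R A] : Module R (Cofree 𝒜 A) :=
  letI := cofreeGmodule (𝒜 := 𝒜) A
  Module.compHom (DirectSum ℤ fun _ => A) (DirectSum.decomposeRingEquiv 𝒜).toRingHom

theorem Cofree.smul_of {A : Type u} [AddCommGroup A] [Module R A] {k : ℤ} {a : R} (ha : a ∈ 𝒜 k)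
    (n : ℤ) (x : A) : a • Cofree.of 𝒜 A n x = Cofree.of 𝒜 A (k + n) (a • x) := by
  let := cofreeGmodule (𝒜 := 𝒜) A
  have h : DirectSum.decompose 𝒜 a = DirectSum.of (fun i => 𝒜 i) k ⟨a, ha⟩ :=
    DirectSum.decompose_of_mem 𝒜 ha
  change DirectSum.decompose 𝒜 a • (DirectSum.of (fun _ : ℤ => A) n x) =
    DirectSum.of (fun _ : ℤ => A) (k + n) (a • x)
  rw [h, DirectSum.Gmodule.of_smul_of]
  rfl

/-- An additive map is linear if it commutes with homogeneous scalars. -/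
theorem map_smul_of_homogeneous {X Y : Type u} [AddCommGroup X] [Module R X] [AddCommGroup Y]
    [Module R Y] (f : X →+ Y) (h : ∀ k, ∀ a ∈ 𝒜 k, ∀ x, f (a • x) = a • f x) (a : R) (x : X) :
    f (a • x) = a • f x := by
  obtain ⟨s, hs⟩ := exists_sum_proj 𝒜 a
  rw [← hs, Finset.sum_smul, Finset.sum_smul, map_sum]
  exact Finset.sum_congr rfl fun n _ => h n _ (proj_mem 𝒜 n a) x

variable (A : Type u) [AddCommGroup A] [Module R A]

/-- The projection of `⨁ₙ A` onto its component of degree `n`. -/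
noncomputable def Cofree.component (n : ℤ) : Cofree 𝒜 A →+ A :=
  DFinsupp.evalAddMonoidHom n

variable (𝒜) in
/-- The cofree graded module on an `R`-module. -/
noncomputable def cofree : GrMod 𝒜 where
  carrier := Cofree 𝒜 A
  deg n := (Cofree.of 𝒜 A n).range
  decomposition := by
    refine DirectSum.IsInternal.chooseDecomposition _ (isInternal_of_proj _
      (fun n => (Cofree.of 𝒜 A n).comp (Cofree.component A n)) ?_ ?_ ?_)
    · rintro n _ ⟨x, rfl⟩
      exact congrArg (Cofree.of 𝒜 A n) (DirectSum.of_eq_same (β := fun _ : ℤ => A) n x)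
    · rintro n m _ ⟨x, rfl⟩ h
      exact (congrArg (Cofree.of 𝒜 A n)
        (DirectSum.of_eq_of_ne (β := fun _ : ℤ => A) m n x (Ne.symm h))).trans (map_zero _)
    · intro x
      induction x using Cofree.induction with
      | zero => exact zero_mem _
      | of n a => exact AddSubgroup.mem_iSup_of_mem n ⟨a, rfl⟩
      | add x y hx hy => exact add_mem hx hy
  gradedSMul := ⟨by
    rintro i j a _ ha ⟨x, rfl⟩
    exact ⟨a • x, (Cofree.smul_of ha j x).symm⟩⟩

/-- The map `⨁ₙ A → A` which adds up the components. -/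
noncomputable def cofreeCounit : (cofree 𝒜 A).carrier →ₗ[R] A :=
  let f : Cofree 𝒜 A →+ A := DirectSum.toAddMonoid fun _ => AddMonoidHom.id A
  { f with
    map_smul' := map_smul_of_homogeneous (𝒜 := 𝒜) f (by
      have hf : ∀ n x, f (Cofree.of 𝒜 A n x) = x := fun n x =>
        DirectSum.toAddMonoid_of (β := fun _ : ℤ => A) (fun _ => AddMonoidHom.id A) n x
      intro k a ha x
      induction x using Cofree.induction with
      | zero => simp
      | of n x => rw [Cofree.smul_of ha, hf, hf]
      | add x y hx hy => rw [smul_add, map_add, hx, hy, map_add, smul_add]) }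

theorem cofreeCounit_of (n : ℤ) (x : A) : cofreeCounit (𝒜 := 𝒜) A (Cofree.of 𝒜 A n x) = x :=
  DirectSum.toAddMonoid_of (β := fun _ : ℤ => A) (fun _ => AddMonoidHom.id A) n x

variable {A}

/-- The additive map underlying `cofreeLift`. -/
noncomputable def cofreeLiftAux (g : N.carrier →ₗ[R] A) : N.carrier →+ Cofree 𝒜 A :=
  (DirectSum.toAddMonoid fun n => (Cofree.of 𝒜 A n).comp
    (g.toAddMonoidHom.comp (N.deg n).subtype)).comp (DirectSum.decomposeAddEquiv N.deg).toAddMonoidHom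

theorem cofreeLiftAux_of_mem (g : N.carrier →ₗ[R] A) {n : ℤ} {x : N.carrier} (hx : x ∈ N.deg n) :
    cofreeLiftAux g x = Cofree.of 𝒜 A n (g x) := by
  change DirectSum.toAddMonoid _ (DirectSum.decompose N.deg x) = _
  rw [DirectSum.decompose_of_mem N.deg hx, DirectSum.toAddMonoid_of]
  rfl

/-- The homogeneous homomorphism into a cofree graded module induced by a linear map. -/
noncomputable def cofreeLift (g : N.carrier →ₗ[R] A) : N ⟶ cofree 𝒜 A where
  lin :=
    { cofreeLiftAux g with
      map_smul' := map_smul_of_homogeneous (𝒜 := 𝒜) (cofreeLiftAux g) (by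
        intro k a ha x
        obtain ⟨s, hs⟩ := exists_sum_proj N.deg x
        rw [← hs, Finset.smul_sum, map_sum, map_sum, Finset.smul_sum]
        refine Finset.sum_congr rfl fun n _ => ?_
        have hx := proj_mem N.deg n x
        rw [cofreeLiftAux_of_mem g hx, Cofree.smul_of ha,
          cofreeLiftAux_of_mem g (SetLike.GradedSMul.smul_mem ha hx), map_smul]
        rfl) }
  map_deg n x hx := ⟨g x, (cofreeLiftAux_of_mem g hx).symm⟩

theorem cofreeLift_of_mem (g : N.carrier →ₗ[R] A) {n : ℤ} {x : N.carrier} (hx : x ∈ N.deg n) :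
    (cofreeLift g).lin x = Cofree.of 𝒜 A n (g x) :=
  cofreeLiftAux_of_mem g hx

theorem cofreeCounit_lift (g : N.carrier →ₗ[R] A) (x : N.carrier) :
    cofreeCounit A ((cofreeLift (𝒜 := 𝒜) g).lin x) = g x := by
  obtain ⟨s, hs⟩ := exists_sum_proj N.deg x
  rw [← hs, map_sum, map_sum, map_sum]
  refine Finset.sum_congr rfl fun n _ => ?_
  rw [cofreeLift_of_mem g (proj_mem N.deg n x), cofreeCounit_of]

theorem cofreeLift_counit (f : N ⟶ cofree 𝒜 A) :
    cofreeLift ((cofreeCounit A).comp f.lin) = f := by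
  refine hom_ext_of_mem fun n x hx => ?_
  obtain ⟨a, ha⟩ := f.map_deg n x hx
  rw [cofreeLift_of_mem _ hx, LinearMap.comp_apply, ← ha, cofreeCounit_of]

theorem comp_cofreeLift (f : M ⟶ N) (g : N.carrier →ₗ[R] A) :
    f ≫ cofreeLift g = cofreeLift (g.comp f.lin) := by
  refine hom_ext_of_mem fun n x hx => ?_
  rw [cofreeLift_of_mem _ hx]
  exact cofreeLift_of_mem g (f.map_deg n x hx)

theorem injective_cofree (E : ModuleCat.{u} R) [Injective E] : Injective (cofree 𝒜 E) where
  factors {X Y} g f _ := by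
    have hm : Mono (ModuleCat.ofHom f.lin) :=
      (ModuleCat.mono_iff_injective _).2 (injective_of_mono f)
    let k : ModuleCat.of R Y.carrier ⟶ E :=
      Injective.factorThru (ModuleCat.ofHom ((cofreeCounit E).comp g.lin)) (ModuleCat.ofHom f.lin)
    have hk : ModuleCat.ofHom f.lin ≫ k = ModuleCat.ofHom ((cofreeCounit E).comp g.lin) :=
      Injective.comp_factorThru _ _
    refine ⟨cofreeLift k.hom, ?_⟩
    have hk' : k.hom.comp f.lin = (cofreeCounit E).comp g.lin := congrArg ModuleCat.Hom.hom hk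
    rw [comp_cofreeLift, hk', cofreeLift_counit]

instance : EnoughInjectives (GrMod 𝒜) where
  presentation X := by
    let E := Injective.under (ModuleCat.of R X.carrier)
    let e : ModuleCat.of R X.carrier ⟶ E := Injective.ι _
    have he : Function.Injective e.hom := (ModuleCat.mono_iff_injective e).1 inferInstance
    exact ⟨{ J := cofree 𝒜 E
             injective := injective_cofree E
             f := cofreeLift e.hom
             mono := mono_of_injective _ fun x y hxy => he (by
               rw [← cofreeCounit_lift (𝒜 := 𝒜) e.hom x, hxy, cofreeCounit_lift]) }⟩

end Cofree

section Torsion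

theorem mem_sub_deg {M : GrMod 𝒜} {p : Submodule R M.carrier}
    {hp : ∀ (n : ℤ) (x : M.carrier), x ∈ p → proj M.deg n x ∈ p} {n : ℤ} (x : p) :
    (show (M.sub p hp).carrier from x) ∈ (M.sub p hp).deg n ↔ x.1 ∈ M.deg n := Iff.rfl

/-- The morphism between graded submodules induced by a homogeneous homomorphism. -/
noncomputable def subMap {M N : GrMod 𝒜} (f : M ⟶ N) {p : Submodule R M.carrier}
    {q : Submodule R N.carrier}
    (hp : ∀ (n : ℤ) (x : M.carrier), x ∈ p → proj M.deg n x ∈ p)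
    (hq : ∀ (n : ℤ) (x : N.carrier), x ∈ q → proj N.deg n x ∈ q)
    (h : ∀ x ∈ p, f.lin x ∈ q) : M.sub p hp ⟶ N.sub q hq where
  lin := f.lin.restrict h
  map_deg n x hx := f.map_deg n (show p from x).1 hx

theorem subMap_id (M : GrMod 𝒜) {p : Submodule R M.carrier}
    (hp : ∀ (n : ℤ) (x : M.carrier), x ∈ p → proj M.deg n x ∈ p) :
    subMap (𝟙 M) hp hp (fun _ h => h) = 𝟙 (M.sub p hp) := Hom.ext (LinearMap.ext fun _ => rfl)

theorem subMap_comp {M N P : GrMod 𝒜} (f : M ⟶ N) (g : N ⟶ P) {p : Submodule R M.carrier}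
    {q : Submodule R N.carrier} {r : Submodule R P.carrier}
    (hp : ∀ (n : ℤ) (x : M.carrier), x ∈ p → proj M.deg n x ∈ p)
    (hq : ∀ (n : ℤ) (x : N.carrier), x ∈ q → proj N.deg n x ∈ q)
    (hr : ∀ (n : ℤ) (x : P.carrier), x ∈ r → proj P.deg n x ∈ r)
    (h : ∀ x ∈ p, f.lin x ∈ q) (h' : ∀ x ∈ q, g.lin x ∈ r) (h'' : ∀ x ∈ p, (f ≫ g).lin x ∈ r) :
    subMap (f ≫ g) hp hr h'' = subMap f hp hq h ≫ subMap g hq hr h' :=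
  Hom.ext (LinearMap.ext fun _ => rfl)

theorem subMap_congr {M N : GrMod 𝒜} {f g : M ⟶ N} (e : f = g) {p : Submodule R M.carrier}
    {q : Submodule R N.carrier}
    (hp : ∀ (n : ℤ) (x : M.carrier), x ∈ p → proj M.deg n x ∈ p)
    (hq : ∀ (n : ℤ) (x : N.carrier), x ∈ q → proj N.deg n x ∈ q)
    (h : ∀ x ∈ p, f.lin x ∈ q) (h' : ∀ x ∈ p, g.lin x ∈ q) :
    subMap f hp hq h = subMap g hp hq h' := by
  subst e
  rfl

variable [GradedRing 𝒜] [IsNoetherianRing R]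

/-- The `(I,J)`-torsion functor on the category of graded modules: the graded submodule
`Γ_{I,J}(M)` of `M`. -/
noncomputable def torsionFunctor (I J : Ideal R) : GrMod 𝒜 ⥤ GrMod 𝒜 where
  obj M := M.sub (torsion I J M.carrier) fun n _ hx => proj_mem_torsion M.deg 𝒜 I J hx n
  map f := subMap f _ _ fun _ hx => map_mem_torsion I J f.lin hx
  map_id M := subMap_id M _
  map_comp f g := subMap_comp f g _ _ _ _ _ _

instance (I J : Ideal R) : (torsionFunctor (𝒜 := 𝒜) I J).Additive where
  map_add := Hom.ext (LinearMap.ext fun _ => rfl)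

/-- The inclusions `Γ_{I,J}(M) ⊆ Γ_{I',J}(M)` for `I' ⊆ I`. -/
noncomputable def torsionInclusion {I I' : Ideal R} (h : I' ≤ I) (J : Ideal R) :
    torsionFunctor (𝒜 := 𝒜) I J ⟶ torsionFunctor I' J where
  app M := subMap (𝟙 M) _ _ (torsion_mono h le_rfl M.carrier)
  naturality M N f := by
    refine (subMap_comp f (𝟙 N) _ _ _ _ _ ?_).symm.trans ?_
    · intro x hx
      exact torsion_mono h le_rfl _ (map_mem_torsion I J f.lin hx)
    · exact subMap_comp (𝟙 M) f _ _ _ _ _ _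

theorem torsionInclusion_refl (I J : Ideal R) :
    torsionInclusion (𝒜 := 𝒜) (le_refl I) J = 𝟙 (torsionFunctor I J) :=
  NatTrans.ext (funext fun M => subMap_id M _)

theorem torsionInclusion_trans {I I' I'' : Ideal R} (h : I' ≤ I) (h' : I'' ≤ I') (J : Ideal R) :
    torsionInclusion (𝒜 := 𝒜) (h'.trans h) J =
      torsionInclusion h J ≫ torsionInclusion h' J :=
  NatTrans.ext (funext fun M => subMap_comp (𝟙 M) (𝟙 M) _ _ _ _ _ _)

end Torsion
end GrMod

end Category

section Derived

universe v₁ v₂ u₁ u₂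

variable {C : Type u₁} [Category.{v₁} C] [Abelian C]

/-- A short exact sequence of injective resolutions `0 → I₁ → I₂ → I₃ → 0` of the terms of a short
complex `0 → X₁ → X₂ → X₃ → 0`, lifting the morphisms of this complex. -/
structure ResolutionSequence (S : ShortComplex C) where
  /-- the resolution of the first term -/
  I₁ : InjectiveResolution S.X₁
  /-- the resolution of the middle term -/
  I₂ : InjectiveResolution S.X₂
  /-- the resolution of the last term -/
  I₃ : InjectiveResolution S.X₃
  /-- the first morphism of complexes -/
  f : I₁.cocomplex ⟶ I₂.cocomplex
  /-- the second morphism of complexes -/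
  g : I₂.cocomplex ⟶ I₃.cocomplex
  zero : f ≫ g = 0
  shortExact : (ShortComplex.mk f g zero).ShortExact
  comm_f : I₁.ι.f 0 ≫ f.f 0 = S.f ≫ I₂.ι.f 0
  comm_g : I₂.ι.f 0 ≫ g.f 0 = S.g ≫ I₃.ι.f 0

/-- An exact sequence `0 → Z → E⁰ → E¹ → ⋯` with injective `Eⁿ` is an injective resolution. -/
noncomputable def resolutionOfExact {Z : C} (E : CochainComplex C ℕ) (hE : ∀ n, Injective (E.X n))
    (i : Z ⟶ E.X 0) (hi : Mono i) (w : i ≫ E.d 0 1 = 0) (h0 : (ShortComplex.mk i (E.d 0 1) w).Exact)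
    (h : ∀ n, E.ExactAt (n + 1)) : InjectiveResolution Z where
  cocomplex := E
  injective := hE
  ι := (CochainComplex.fromSingle₀Equiv _ _).symm ⟨i, w⟩
  quasiIso := ⟨fun n => by
    cases n
    · rw [CochainComplex.quasiIsoAt₀_iff, ShortComplex.quasiIso_iff_of_zeros]
      · refine (ShortComplex.exact_and_mono_f_iff_of_iso ?_).2 ⟨h0, hi⟩
        exact ShortComplex.isoMk (Iso.refl _) (Iso.refl _) (Iso.refl _)
          (by simp; exact (Category.id_comp i).trans (Category.comp_id i).symm)
          (by simp; exact (Category.id_comp (E.d 0 1)).trans (Category.comp_id (E.d 0 1)).symm)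
      all_goals first | rfl | exact E.shape 0 0 (by simp)
    · rw [quasiIsoAt_iff_exactAt]
      · apply h
      · apply CochainComplex.exactAt_succ_single_obj⟩

theorem resolutionOfExact_ι {Z : C} (E : CochainComplex C ℕ) (hE : ∀ n, Injective (E.X n))
    (i : Z ⟶ E.X 0) (hi : Mono i) (w : i ≫ E.d 0 1 = 0) (h0 : (ShortComplex.mk i (E.d 0 1) w).Exact)
    (h : ∀ n, E.ExactAt (n + 1)) : (resolutionOfExact E hE i hi w h0 h).ι.f 0 = i := by
  simp [resolutionOfExact]

/-- The twisting morphisms in the horseshoe lemma. -/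
theorem exists_twist {S : ShortComplex C} (hS : S.ShortExact) (I : InjectiveResolution S.X₁)
    (K : InjectiveResolution S.X₃) :
    ∃ (α : S.X₂ ⟶ I.cocomplex.X 0) (τ : ∀ n, K.cocomplex.X n ⟶ I.cocomplex.X (n + 1)),
      S.f ≫ α = I.ι.f 0 ∧ S.g ≫ K.ι.f 0 ≫ τ 0 = - α ≫ I.cocomplex.d 0 1 ∧
      ∀ n, K.cocomplex.d n (n + 1) ≫ τ (n + 1) = - τ n ≫ I.cocomplex.d (n + 1) (n + 2) := by
  have := hS.mono_f
  have := hS.epi_g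
  let ιI : S.X₁ ⟶ I.cocomplex.X 0 := I.ι.f 0
  let ιK : S.X₃ ⟶ K.cocomplex.X 0 := K.ι.f 0
  have hιI : ιI ≫ I.cocomplex.d 0 1 = 0 := I.ι_f_zero_comp_complex_d
  have hιK : Mono ιK := inferInstanceAs (Mono (K.ι.f 0))
  let α : S.X₂ ⟶ I.cocomplex.X 0 := Injective.factorThru ιI S.f
  have hα : S.f ≫ α = ιI := Injective.comp_factorThru _ _
  obtain ⟨β, hβ⟩ := CokernelCofork.IsColimit.desc' hS.gIsCokernel (α ≫ I.cocomplex.d 0 1)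
    (by rw [← Category.assoc, hα, hιI])
  replace hβ : S.g ≫ β = α ≫ I.cocomplex.d 0 1 := hβ
  have hβd : β ≫ I.cocomplex.d 1 2 = 0 := by
    rw [← cancel_epi S.g, ← Category.assoc, hβ, Category.assoc, HomologicalComplex.d_comp_d,
      comp_zero, comp_zero]
  let t₀ : K.cocomplex.X 0 ⟶ I.cocomplex.X 1 := Injective.factorThru (-β) ιK
  have ht₀ : ιK ≫ t₀ = -β := Injective.comp_factorThru _ _
  have h1 : ∃ t₁ : K.cocomplex.X 1 ⟶ I.cocomplex.X 2,
      K.cocomplex.d 0 1 ≫ t₁ = - t₀ ≫ I.cocomplex.d 1 2 :=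
    ⟨_, K.exact₀.comp_descToInjective (- t₀ ≫ I.cocomplex.d 1 2) (by
      change ιK ≫ (- t₀ ≫ I.cocomplex.d 1 2) = 0
      rw [Preadditive.comp_neg, ← Category.assoc, ht₀, Preadditive.neg_comp, hβd, neg_zero, neg_zero])⟩
  have hstep : ∀ (n : ℕ) (t : K.cocomplex.X (n + 1) ⟶ I.cocomplex.X (n + 2)),
      K.cocomplex.d n (n + 1) ≫ t ≫ I.cocomplex.d (n + 2) (n + 3) = 0 →
      ∃ t' : K.cocomplex.X (n + 2) ⟶ I.cocomplex.X (n + 3),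
        K.cocomplex.d (n + 1) (n + 2) ≫ t' = - t ≫ I.cocomplex.d (n + 2) (n + 3) := fun n t ht =>
    ⟨_, (K.exact_succ n).comp_descToInjective (- t ≫ I.cocomplex.d (n + 2) (n + 3)) (by
      change K.cocomplex.d n (n + 1) ≫ (- t ≫ I.cocomplex.d (n + 2) (n + 3)) = 0
      rw [Preadditive.comp_neg, ht, neg_zero])⟩
  obtain ⟨t₁, ht₁⟩ := h1
  choose next hnext using hstep
  let σ : ∀ n : ℕ, { t : K.cocomplex.X (n + 1) ⟶ I.cocomplex.X (n + 2) //
      K.cocomplex.d n (n + 1) ≫ t ≫ I.cocomplex.d (n + 2) (n + 3) = 0 } := fun n =>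
    Nat.rec ⟨t₁, by
        rw [← Category.assoc, ht₁, Preadditive.neg_comp, Category.assoc,
          HomologicalComplex.d_comp_d, comp_zero, neg_zero]⟩
      (fun n t => ⟨next n t.1 t.2, by
        rw [← Category.assoc, hnext, Preadditive.neg_comp, Category.assoc,
          HomologicalComplex.d_comp_d, comp_zero, neg_zero]⟩) n
  refine ⟨α, fun n => Nat.casesOn n t₀ fun n => (σ n).1, hα, ?_, ?_⟩
  · change S.g ≫ ιK ≫ t₀ = _
    rw [ht₀, Preadditive.comp_neg, hβ]
  · intro n
    cases n with
    | zero => exact ht₁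
    | succ n => exact hnext n _ _

/-- The horseshoe lemma. -/
theorem nonempty_resolutionSequence [HasInjectiveResolutions C] {S : ShortComplex C}
    (hS : S.ShortExact) : Nonempty (ResolutionSequence S) := by
  have := hS.mono_f
  have := hS.epi_g
  let I := injectiveResolution S.X₁
  let K := injectiveResolution S.X₃
  obtain ⟨α, τ, hα, hτ₀, hτ⟩ := exists_twist hS I K
  let ιI : S.X₁ ⟶ I.cocomplex.X 0 := I.ι.f 0
  let ιK : S.X₃ ⟶ K.cocomplex.X 0 := K.ι.f 0
  have hmI : Mono ιI := inferInstanceAs (Mono (I.ι.f 0))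
  have hmK : Mono ιK := inferInstanceAs (Mono (K.ι.f 0))
  replace hα : S.f ≫ α = ιI := hα
  replace hτ₀ : S.g ≫ ιK ≫ τ 0 = - α ≫ I.cocomplex.d 0 1 := hτ₀
  let X : ℕ → C := fun n => I.cocomplex.X n ⊞ K.cocomplex.X n
  let d : ∀ n, X n ⟶ X (n + 1) := fun n =>
    biprod.desc (I.cocomplex.d n (n + 1) ≫ biprod.inl)
      (τ n ≫ biprod.inl + K.cocomplex.d n (n + 1) ≫ biprod.inr)
  have hd : ∀ n, d n ≫ d (n + 1) = 0 := by
    intro n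
    apply biprod.hom_ext'
    · simp [d]
    · simp [d, reassoc_of% hτ n]
  let E : CochainComplex C ℕ := CochainComplex.of X d hd
  have hEd : ∀ n, E.d n (n + 1) = d n := fun n => CochainComplex.of_d X d n
  let f : I.cocomplex ⟶ E :=
    { f := fun n => (biprod.inl : _ ⟶ I.cocomplex.X n ⊞ K.cocomplex.X n)
      comm' := by
        rintro n _ rfl
        rw [hEd]
        exact biprod.inl_desc _ _ }
  let g : E ⟶ K.cocomplex :=
    { f := fun n => (biprod.snd : I.cocomplex.X n ⊞ K.cocomplex.X n ⟶ _)
      comm' := by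
        rintro n _ rfl
        rw [hEd]
        apply biprod.hom_ext' <;> simp [d] }
  have hfg : f ≫ g = 0 := by
    ext n
    exact biprod.inl_snd
  have hse : (ShortComplex.mk f g hfg).ShortExact :=
    HomologicalComplex.shortExact_of_degreewise_shortExact _ fun n =>
      (ShortComplex.Splitting.ofHasBinaryBiproduct (I.cocomplex.X n) (K.cocomplex.X n)).shortExact
  have hinj : ∀ n, Injective (E.X n) := fun n =>
    inferInstanceAs (Injective (I.cocomplex.X n ⊞ K.cocomplex.X n))
  let i : S.X₂ ⟶ I.cocomplex.X 0 ⊞ K.cocomplex.X 0 := biprod.lift α (S.g ≫ ιK)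
  have hi : Mono i := by
    refine Preadditive.mono_of_cancel_zero _ fun x hx => ?_
    have h1 : x ≫ α = 0 := by simpa [i] using hx =≫ biprod.fst
    have h2 : x ≫ S.g = 0 := by
      rw [← cancel_mono ιK, Category.assoc, zero_comp]
      simpa [i] using hx =≫ biprod.snd
    obtain ⟨y, hy⟩ := KernelFork.IsLimit.lift' hS.fIsKernel x h2
    replace hy : y ≫ S.f = x := hy
    have : y = 0 := by rw [← cancel_mono ιI, ← hα, ← Category.assoc, hy, h1, zero_comp]
    rw [← hy, this, zero_comp]
  have hid : i ≫ d 0 = 0 := by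
    simp only [i, d, biprod.lift_desc, Preadditive.comp_add]
    have h3 : S.g ≫ ιK ≫ K.cocomplex.d 0 1 = 0 := by
      rw [show ιK ≫ K.cocomplex.d 0 1 = 0 from K.ι_f_zero_comp_complex_d, comp_zero]
    simp only [Category.assoc, reassoc_of% hτ₀, reassoc_of% h3]
    simp
  have hexact : (ShortComplex.mk i (d 0) hid).Exact := by
    rw [ShortComplex.exact_iff_exact_up_to_refinements]
    intro A e he
    replace he : e ≫ d 0 = 0 := he
    change A ⟶ I.cocomplex.X 0 ⊞ K.cocomplex.X 0 at e
    have h2 : (e ≫ biprod.snd) ≫ K.cocomplex.d 0 1 = 0 := by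
      have : d 0 ≫ biprod.snd = biprod.snd ≫ K.cocomplex.d 0 1 := by
        apply biprod.hom_ext' <;> simp [d]
      rw [Category.assoc, ← this, ← Category.assoc, he, zero_comp]
    obtain ⟨y, hy⟩ : ∃ y : A ⟶ S.X₃, y ≫ ιK = e ≫ biprod.snd :=
      ⟨_, (KernelFork.IsLimit.lift' K.isLimitKernelFork _ h2).2⟩
    obtain ⟨A', π, hπ, m, hm⟩ := surjective_up_to_refinements_of_epi S.g y
    let r : A' ⟶ I.cocomplex.X 0 := π ≫ e ≫ biprod.fst - m ≫ α
    have hr : π ≫ e = m ≫ i + r ≫ biprod.inl := by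
      apply biprod.hom_ext
      · simp [r, i]
      · simp only [i, Category.assoc, Preadditive.add_comp, biprod.lift_snd, biprod.inl_snd,
          comp_zero, add_zero, ← hy, reassoc_of% hm]
    have hrd : r ≫ I.cocomplex.d 0 1 = 0 := by
      have h4 : (r ≫ biprod.inl) ≫ d 0 = 0 := by
        rw [eq_sub_of_add_eq' hr.symm, Preadditive.sub_comp, Category.assoc, Category.assoc,
          he, hid, comp_zero, comp_zero, sub_zero]
      simpa [d] using h4 =≫ biprod.fst
    obtain ⟨l, hl⟩ : ∃ l : A' ⟶ S.X₁, l ≫ ιI = r :=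
      ⟨_, (KernelFork.IsLimit.lift' I.isLimitKernelFork _ hrd).2⟩
    refine ⟨A', π, hπ, m + l ≫ S.f, ?_⟩
    change π ≫ e = (m + l ≫ S.f) ≫ i
    rw [hr, Preadditive.add_comp, ← hl, ← hα]
    congr 1
    apply biprod.hom_ext <;> simp [i]
  have hid' : i ≫ E.d 0 1 = 0 := (congrArg (fun k => i ≫ k) (hEd 0)).trans hid
  have hexact' : (ShortComplex.mk (X₂ := E.X 0) (X₃ := E.X 1) i (E.d 0 1) hid').Exact := by
    convert hexact
    exact hEd 0
  let M := resolutionOfExact E hinj i hi hid' hexact' fun n =>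
    hse.exactAt_X₂ (n + 1) (I.cocomplex_exactAt_succ n) (K.cocomplex_exactAt_succ n)
  have hM : M.ι.f 0 = i := resolutionOfExact_ι ..
  refine ⟨⟨I, M, K, f, g, hfg, hse, ?_, ?_⟩⟩
  · rw [hM]
    change ιI ≫ biprod.inl = S.f ≫ i
    apply biprod.hom_ext <;> simp [i, hα]
  · rw [hM]
    change i ≫ biprod.snd = S.g ≫ ιK
    simp [i]

/-- A sequence of functors together with connecting morphisms
`Tⁱ(X₃) ⟶ Tⁱ⁺¹(X₁)` for all short exact sequences `0 → X₁ → X₂ → X₃ → 0`. -/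
structure FunctorSequence (C : Type u₁) [Category.{v₁} C] [Abelian C] (D : Type u₂)
    [Category.{v₂} D] where
  /-- the functors -/
  T : ℕ → C ⥤ D
  /-- the connecting morphisms -/
  δ : ∀ (S : ShortComplex C), S.ShortExact → ∀ i : ℕ, (T i).obj S.X₃ ⟶ (T (i + 1)).obj S.X₁

namespace FunctorSequence

section

variable {D : Type u₂} [Category.{v₂} D]

/-- A morphism of sequences: natural transformations which commute with the connecting
morphisms. -/
@[ext]
structure Hom (F G : FunctorSequence C D) where
  /-- the natural transformations -/
  app : ∀ i : ℕ, F.T i ⟶ G.T i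
  comm : ∀ (S : ShortComplex C) (hS : S.ShortExact) (i : ℕ),
    F.δ S hS i ≫ (app (i + 1)).app S.X₁ = (app i).app S.X₃ ≫ G.δ S hS i

instance : Category (FunctorSequence C D) where
  Hom := Hom
  id F := ⟨fun _ => 𝟙 _, fun S hS i => by
    rw [NatTrans.id_app, NatTrans.id_app, Category.comp_id, Category.id_comp]⟩
  comp f g := ⟨fun i => f.app i ≫ g.app i, fun S hS i => by
    rw [NatTrans.comp_app, NatTrans.comp_app, ← Category.assoc, f.comm, Category.assoc, g.comm,
      Category.assoc]⟩
  id_comp f := Hom.ext (funext fun i => Category.id_comp (f.app i))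
  comp_id f := Hom.ext (funext fun i => Category.comp_id (f.app i))
  assoc f g h := Hom.ext (funext fun i => Category.assoc (f.app i) (g.app i) (h.app i))

/-- The `i`-th functor of a sequence, as a functor of the sequence. -/
def term (i : ℕ) : FunctorSequence C D ⥤ C ⥤ D where
  obj F := F.T i
  map f := Hom.app f i

/-- The connecting morphisms for a fixed short exact sequence are natural in the sequence of
functors. -/
def connecting (S : ShortComplex C) (hS : S.ShortExact) (i : ℕ) :
    term i ⋙ (evaluation C D).obj S.X₃ ⟶ term (i + 1) ⋙ (evaluation C D).obj S.X₁ where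
  app F := F.δ S hS i
  naturality _ _ f := (Hom.comm f S hS i).symm

/-- The colimit of a diagram of sequences of functors: the colimits of the functors, with the
colimits of the connecting morphisms. -/
noncomputable def colim {K : Type*} [Category K] [HasColimitsOfShape K D]
    (Φ : K ⥤ FunctorSequence C D) : FunctorSequence C D where
  T i := colimit (Φ ⋙ term i)
  δ S hS i :=
    (colimitObjIsoColimitCompEvaluation (Φ ⋙ term i) S.X₃).hom ≫
      colimMap (Functor.whiskerLeft Φ (connecting S hS i)) ≫
        (colimitObjIsoColimitCompEvaluation (Φ ⋙ term (i + 1)) S.X₁).inv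

end

/-- A sequence of functors is strongly connected if its connecting morphisms are natural in the
short exact sequence `0 → X₁ → X₂ → X₃ → 0` and make
`0 → T⁰(X₁) → T⁰(X₂) → T⁰(X₃) → T¹(X₁) → T¹(X₂) → ⋯` a long exact sequence. -/
structure IsStronglyConnected {D : Type u₂} [Category.{v₂} D] [Abelian D]
    (F : FunctorSequence C D) : Prop where
  naturality : ∀ {S S' : ShortComplex C} (φ : S ⟶ S') (hS : S.ShortExact) (hS' : S'.ShortExact)
    (i : ℕ), F.δ S hS i ≫ (F.T (i + 1)).map φ.τ₁ = (F.T i).map φ.τ₃ ≫ F.δ S' hS' i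
  mono : ∀ S : ShortComplex C, S.ShortExact → Mono ((F.T 0).map S.f)
  exact₂ : ∀ S : ShortComplex C, S.ShortExact → ∀ i : ℕ,
    ∃ w : (F.T i).map S.f ≫ (F.T i).map S.g = 0, (ShortComplex.mk _ _ w).Exact
  exact₃ : ∀ (S : ShortComplex C) (hS : S.ShortExact) (i : ℕ),
    ∃ w : (F.T i).map S.g ≫ F.δ S hS i = 0, (ShortComplex.mk _ _ w).Exact
  exact₁ : ∀ (S : ShortComplex C) (hS : S.ShortExact) (i : ℕ),
    ∃ w : F.δ S hS i ≫ (F.T (i + 1)).map S.f = 0, (ShortComplex.mk _ _ w).Exact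

end FunctorSequence

section RightDerived

variable {D : Type u₂} [Category.{v₂} D] [Abelian D]

namespace ResolutionSequence

variable {S : ShortComplex C} (E : ResolutionSequence S) (F : C ⥤ D) [F.Additive]

/-- The sequence of complexes obtained by applying an additive functor. -/
noncomputable def mapComplex : ShortComplex (CochainComplex D ℕ) :=
  (ShortComplex.mk E.f E.g E.zero).map (F.mapHomologicalComplex (ComplexShape.up ℕ))

theorem mapComplex_shortExact : (E.mapComplex F).ShortExact := by
  refine HomologicalComplex.shortExact_of_degreewise_shortExact _ fun n => ?_
  have h := (HomologicalComplex.shortExact_iff_degreewise_shortExact _).1 E.shortExact n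
  have : Injective ((ShortComplex.mk E.f E.g E.zero).map
      (HomologicalComplex.eval C (ComplexShape.up ℕ) n)).X₁ := E.I₁.injective n
  exact (h.splittingOfInjective.map F).shortExact

end ResolutionSequence

variable [HasInjectiveResolutions C]

/-- The connecting morphisms of the right derived functors of `F`: apply `F` to a short exact
sequence of injective resolutions and take the connecting morphism of the resulting short exact
sequence of complexes. -/
noncomputable def rightDerivedConnecting (F : C ⥤ D) [F.Additive] (S : ShortComplex C)
    (hS : S.ShortExact) (i : ℕ) :
    (F.rightDerived i).obj S.X₃ ⟶ (F.rightDerived (i + 1)).obj S.X₁ :=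
  let E : ResolutionSequence S := (nonempty_resolutionSequence hS).some
  (E.I₃.isoRightDerivedObj F i).hom ≫ (E.mapComplex_shortExact F).δ i (i + 1) rfl ≫
    (E.I₁.isoRightDerivedObj F (i + 1)).inv

/-- The sequence of right derived functors. -/
noncomputable def rightDerivedSequence (F : C ⥤ D) [F.Additive] : FunctorSequence C D where
  T i := F.rightDerived i
  δ S hS i := rightDerivedConnecting F S hS i

theorem connecting_aux {D : Type u₂} [Category.{v₂} D] {A₁ A₃ B₁ B₃ A₁' A₃' B₁' B₃' : D} (a₃ : A₃ ≅ A₃') (a₁ : A₁ ≅ A₁')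
    (b₃ : B₃ ≅ B₃') (b₁ : B₁ ≅ B₁') {d : A₃' ⟶ A₁'} {e : B₃' ⟶ B₁'} {m₁ : A₁' ⟶ B₁'}
    {m₃ : A₃' ⟶ B₃'} (h : d ≫ m₁ = m₃ ≫ e) :
    (a₃.hom ≫ d ≫ a₁.inv) ≫ (a₁.hom ≫ m₁ ≫ b₁.inv) =
      (a₃.hom ≫ m₃ ≫ b₃.inv) ≫ (b₃.hom ≫ e ≫ b₁.inv) := by
  simp [reassoc_of% h]

/-- A natural transformation induces a morphism between the sequences of right derived functors. -/
noncomputable def rightDerivedSequenceMap {F G : C ⥤ D} [F.Additive] [G.Additive] (α : F ⟶ G) :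
    rightDerivedSequence F ⟶ rightDerivedSequence G where
  app i := NatTrans.rightDerived α i
  comm S hS i := by
    let E : ResolutionSequence S := (nonempty_resolutionSequence hS).some
    let φ : E.mapComplex F ⟶ E.mapComplex G :=
      ShortComplex.mapNatTrans _ (NatTrans.mapHomologicalComplex α (ComplexShape.up ℕ))
    have h := HomologicalComplex.HomologySequence.δ_naturality φ (E.mapComplex_shortExact F)
      (E.mapComplex_shortExact G) i (i + 1) rfl
    change ((E.I₃.isoRightDerivedObj F i).hom ≫ (E.mapComplex_shortExact F).δ i (i + 1) rfl ≫
      (E.I₁.isoRightDerivedObj F (i + 1)).inv) ≫ (NatTrans.rightDerived α (i + 1)).app S.X₁ =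
      (NatTrans.rightDerived α i).app S.X₃ ≫ ((E.I₃.isoRightDerivedObj G i).hom ≫
      (E.mapComplex_shortExact G).δ i (i + 1) rfl ≫ (E.I₁.isoRightDerivedObj G (i + 1)).inv)
    rw [InjectiveResolution.rightDerived_app_eq α E.I₁,
      InjectiveResolution.rightDerived_app_eq α E.I₃]
    exact connecting_aux (E.I₃.isoRightDerivedObj F i) (E.I₁.isoRightDerivedObj F (i + 1))
      (E.I₃.isoRightDerivedObj G i) (E.I₁.isoRightDerivedObj G (i + 1)) h

theorem rightDerivedSequenceMap_id (F : C ⥤ D) [F.Additive] :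
    rightDerivedSequenceMap (𝟙 F) = 𝟙 (rightDerivedSequence F) :=
  FunctorSequence.Hom.ext (funext fun i => NatTrans.rightDerived_id F i)

theorem rightDerivedSequenceMap_comp {F G H : C ⥤ D} [F.Additive] [G.Additive] [H.Additive]
    (α : F ⟶ G) (β : G ⟶ H) :
    rightDerivedSequenceMap (α ≫ β) = rightDerivedSequenceMap α ≫ rightDerivedSequenceMap β :=
  FunctorSequence.Hom.ext (funext fun i => NatTrans.rightDerived_comp α β i)

end RightDerived

end Derived

section LocalCohomology

variable {R : Type u} [CommRing R] (𝒜 : ℤ → AddSubgroup R) [GradedRing 𝒜]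

/-- The set `*W̃(I,J)` of the homogeneous ideals `𝔞` with `Iⁿ ⊆ 𝔞 + J` for some `n ≥ 1`. -/
def WTilde (I J : Ideal R) : Type u :=
  {𝔞 : Ideal R // 𝔞.IsHomogeneous 𝒜 ∧ ∃ n : ℕ, 1 ≤ n ∧ I ^ n ≤ 𝔞 ⊔ J}

/-- The partial order on `*W̃(I,J)`: `𝔞 ≤ 𝔟` if `𝔞 ⊇ 𝔟`. -/
instance (I J : Ideal R) : PartialOrder (WTilde 𝒜 I J) :=
  PartialOrder.lift (fun 𝔞 => OrderDual.toDual 𝔞.1)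
    fun _ _ h => Subtype.ext (OrderDual.toDual.injective h)

theorem WTilde.le_iff {I J : Ideal R} (𝔞 𝔟 : WTilde 𝒜 I J) : 𝔞 ≤ 𝔟 ↔ 𝔟.1 ≤ 𝔞.1 := Iff.rfl

variable [IsNoetherianRing R]

/-- The graded local cohomology functors `*Hⁱ_{I,J}`, with their connecting morphisms: the right
derived functors of `Γ_{I,J}` on the category of graded modules. -/
noncomputable def gradedLocalCohomology (I J : Ideal R) : FunctorSequence (GrMod 𝒜) (GrMod 𝒜) :=
  rightDerivedSequence (GrMod.torsionFunctor I J)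

/-- The direct system of the sequences `(*Hⁱ_𝔞)ᵢ`, where `𝔞` runs through `*W̃(I,J)`. Here
`Γ_𝔞 = Γ_{𝔞,0}` and `*Hⁱ_𝔞 = *Hⁱ_{𝔞,0}`, and the transition morphisms are induced by the inclusions
`Γ_𝔞(M) ⊆ Γ_𝔟(M)` for `𝔞 ⊇ 𝔟`. -/
noncomputable def localCohomologySystem (I J : Ideal R) :
    WTilde 𝒜 I J ⥤ FunctorSequence (GrMod 𝒜) (GrMod 𝒜) where
  obj 𝔞 := gradedLocalCohomology 𝒜 𝔞.1 ⊥
  map {𝔞 𝔟} h := rightDerivedSequenceMap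
    (F := GrMod.torsionFunctor 𝔞.1 ⊥) (G := GrMod.torsionFunctor 𝔟.1 ⊥)
    (GrMod.torsionInclusion ((WTilde.le_iff 𝒜 𝔞 𝔟).1 (leOfHom h)) ⊥)
  map_id 𝔞 := (congrArg (fun α => rightDerivedSequenceMap (F := GrMod.torsionFunctor 𝔞.1 ⊥)
      (G := GrMod.torsionFunctor 𝔞.1 ⊥) α) (GrMod.torsionInclusion_refl 𝔞.1 ⊥)).trans
    (rightDerivedSequenceMap_id (GrMod.torsionFunctor 𝔞.1 ⊥))
  map_comp {𝔞 𝔟 𝔠} f g := (congrArg (fun α => rightDerivedSequenceMap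
      (F := GrMod.torsionFunctor 𝔞.1 ⊥) (G := GrMod.torsionFunctor 𝔠.1 ⊥) α)
      (GrMod.torsionInclusion_trans ((WTilde.le_iff 𝒜 𝔞 𝔟).1 (leOfHom f))
        ((WTilde.le_iff 𝒜 𝔟 𝔠).1 (leOfHom g)) ⊥)).trans
    (rightDerivedSequenceMap_comp
      (F := GrMod.torsionFunctor 𝔞.1 ⊥) (G := GrMod.torsionFunctor 𝔟.1 ⊥)
      (H := GrMod.torsionFunctor 𝔠.1 ⊥) _ _)

end LocalCohomology

end GradedLC

/-! The heart of the matter is that `Γ_{I,J}(M)` is the directed union of the submodules `Γ_𝔞(M)`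
with `𝔞` in `*W̃(I,J)`. Each `Γ_𝔞(M)` lies in `Γ_{I,J}(M)`, because `Iⁿ ⊆ 𝔞 + J` gives `Iⁿᵐ ⊆ 𝔞ᵐ +
J`. Conversely, the homogeneous components of an `(I,J)`-torsion element are again `(I,J)`-torsion,
the annihilator of a homogeneous torsion element is itself a member of `*W̃(I,J)`, and finitely many
members have a common upper bound, built from products (`exists_mem_torsion`).

The inclusions `Γ_𝔞 ⊆ Γ_{I,J}` induce a morphism of sequences from the colimit of the `(*Hⁱ_𝔞)ᵢ` to
`(*Hⁱ_{I,J})ᵢ` (`comparison`). Both sequences are strongly connected and vanish on injectives in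
positive degrees, so dimension shifting (`isIso_app_of_injective`) reduces everything to degree zero
on injectives. There a zeroth derived functor agrees with the original functor, and the claim
becomes the statement about unions.

Two inputs are general. Right derived functors form a strongly connected sequence: the horseshoe
lemma provides the connecting morphisms, and their naturality follows by lifting a morphism of short
exact sequences to the resolutions (`exists_hom`). Strong connectedness passes to filtered colimits
because these are exact on graded modules: forgetting the grading is exact, reflects isomorphisms
and has the cofree module as right adjoint, so exactness is inherited from modules. -/

namespace GradedLC

/-! ### Right derived functors: naturality of connecting morphisms and long exact sequences. -/

section DerivedSequences

universe v₁ v₂ u₁ u₂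

variable {C : Type u₁} [Category.{v₁} C]

theorem comp_square {X Y Z X' Y' Z' : C} {x : X ⟶ X'} {y : Y ⟶ Y'} {z : Z ⟶ Z'} {f : X ⟶ Y}
    {g : Y ⟶ Z} {f' : X' ⟶ Y'} {g' : Y' ⟶ Z'} (h : x ≫ f' = f ≫ y) (h' : y ≫ g' = g ≫ z) :
    x ≫ f' ≫ g' = (f ≫ g) ≫ z := by
  rw [reassoc_of% h, h', Category.assoc]

theorem square_of_naturality {X₁ X₃ Y₁ Y₃ K₁ K₃ L₁ L₃ : C}
    {x₁ : K₁ ⟶ X₁} {x₃ : X₃ ⟶ K₃} {y₁ : L₁ ⟶ Y₁} {y₃ : Y₃ ⟶ L₃} {d : K₃ ⟶ K₁} {e : L₃ ⟶ L₁}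
    {f₁ : X₁ ⟶ Y₁} {f₃ : X₃ ⟶ Y₃} {g₁ : K₁ ⟶ L₁} {g₃ : K₃ ⟶ L₃} (h₁ : x₁ ≫ f₁ = g₁ ≫ y₁)
    (h₃ : f₃ ≫ y₃ = x₃ ≫ g₃) (h : d ≫ g₁ = g₃ ≫ e) :
    (x₃ ≫ d ≫ x₁) ≫ f₁ = f₃ ≫ y₃ ≫ e ≫ y₁ := by
  rw [reassoc_of% h₃, ← reassoc_of% h, Category.assoc, Category.assoc, h₁]

theorem conj_comp_hom {X Y X' Y' : C} (x : X ≅ X') (d : X' ⟶ Y') (y : Y ≅ Y') :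
    (x.hom ≫ d ≫ y.inv) ≫ y.hom = x.hom ≫ d := by
  simp

theorem triple_square {X Y X' Y' Z Z' : C} {x : X ⟶ X'} {y : Y ⟶ Y'} {a : X' ⟶ Z} {b : X ⟶ Z}
    {c : Z ⟶ Z'} {b' : Y ⟶ Z'} {e : Z' ⟶ Y'} {d : X ⟶ Y} (ha : x ≫ a = b) (hc : b ≫ c = d ≫ b')
    (he : b' ≫ e = y) : x ≫ a ≫ c ≫ e = d ≫ y := by
  rw [reassoc_of% ha, reassoc_of% hc, he]

/-- Five faces of a cube force the sixth after precomposition with `x₃`. With the legs of colimit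
cocones as the `x` and `y`, this carries commutative squares from the terms of a diagram to its
colimit, since the legs are jointly epimorphic. -/
theorem cube_face {X₁ X₃ Y₁ Y₃ Z₁ Z₃ W₁ W₃ : C} {x₁ : Z₁ ⟶ X₁} {x₃ : Z₃ ⟶ X₃} {y₁ : W₁ ⟶ Y₁}
    {y₃ : W₃ ⟶ Y₃} {d : X₃ ⟶ X₁} {d' : Z₃ ⟶ Z₁} {e : Y₃ ⟶ Y₁} {e' : W₃ ⟶ W₁} {m₁ : X₁ ⟶ Y₁}
    {m₃ : X₃ ⟶ Y₃} {n₁ : Z₁ ⟶ W₁} {n₃ : Z₃ ⟶ W₃} (hd : x₃ ≫ d = d' ≫ x₁)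
    (he : y₃ ≫ e = e' ≫ y₁) (h₁ : x₁ ≫ m₁ = n₁ ≫ y₁) (h₃ : x₃ ≫ m₃ = n₃ ≫ y₃)
    (h : d' ≫ n₁ = n₃ ≫ e') : x₃ ≫ d ≫ m₁ = x₃ ≫ m₃ ≫ e := by
  rw [reassoc_of% hd, h₁, reassoc_of% h, reassoc_of% h₃, he]

theorem conj_square {X Y Z Z' K K' H H' : C} {t : X ⟶ Z} {t' : Y ⟶ Z'} {a : X ⟶ Y} {m : Z ⟶ Z'}
    {p : Z ⟶ K} {p' : Z' ⟶ K'} {n : K ⟶ K'} (i : H ≅ K) (i' : H' ≅ K') (h : t ≫ m = a ≫ t')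
    (h' : p ≫ n = m ≫ p') : (t ≫ p ≫ i.inv) ≫ i.hom ≫ n ≫ i'.inv = a ≫ t' ≫ p' ≫ i'.inv := by
  simp [reassoc_of% h', reassoc_of% h]

theorem comp_eq_of_square {A B A' B' Y : C} {t : A ⟶ B} {r : B ⟶ B'} {p : A ⟶ A'} {t' : A' ⟶ B'}
    {c : B ⟶ Y} {c' : B' ⟶ Y} (h : t ≫ r = p ≫ t') (hc : r ≫ c' = c) :
    p ≫ t' ≫ c' = t ≫ c := by
  rw [← reassoc_of% h, hc]

/-- A morphism is invertible if its source and target are detected by two isomorphic families of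
morphisms, and its inverse is defined on the second one. -/
theorem isIso_of_glue {κ : Type*} {A B : κ → C} {X Y Z : C} {t : ∀ k, A k ⟶ B k}
    {j : ∀ k, A k ⟶ X} {c : ∀ k, B k ⟶ Y} {r : ∀ k, B k ⟶ Z} {T : X ⟶ Z} {f : Y ⟶ Z} {d : X ⟶ Y}
    (ht : ∀ k, IsIso (t k)) (hT : IsIso T) (hf : ∀ k, c k ≫ f = r k)
    (hr : ∀ k, t k ≫ r k = j k ≫ T) (hd : ∀ k, j k ≫ d = t k ≫ c k)
    (hX : ∀ {W : C} {x y : X ⟶ W}, (∀ k, j k ≫ x = j k ≫ y) → x = y)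
    (hY : ∀ {W : C} {x y : Y ⟶ W}, (∀ k, c k ≫ x = c k ≫ y) → x = y) : IsIso f := by
  -- As `T` is invertible, `d` becomes a right inverse of `f` after correction by `inv T`; it
  -- remains to check the other composite on the family `c`, where the invertible `t k` can be
  -- cancelled.
  have hdf : d ≫ f = T := hX fun k => by rw [reassoc_of% hd k, hf, hr]
  refine ⟨inv T ≫ d, hY fun k => ?_, by rw [Category.assoc, hdf, IsIso.inv_hom_id]⟩
  rw [← cancel_epi (t k), reassoc_of% hf k, reassoc_of% hr k, IsIso.hom_inv_id_assoc, hd,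
    Category.comp_id]

/-- A commutative square on the middle terms passes to the quotients, because `p` can be cancelled.
-/
theorem descend_square {X₂ X₃ Y₂ Y₃ X₂' X₃' Y₂' Y₃' : C} {p : X₂ ⟶ X₃} (hp : Epi p) {q : Y₂ ⟶ Y₃}
    {p' : X₂' ⟶ X₃'} {q' : Y₂' ⟶ Y₃'} {x₂ : X₂ ⟶ X₂'} {x₃ : X₃ ⟶ X₃'} {y₂ : Y₂ ⟶ Y₂'}
    {y₃ : Y₃ ⟶ Y₃'} {f₂ : X₂ ⟶ Y₂} {f₃ : X₃ ⟶ Y₃} {g₂ : X₂' ⟶ Y₂'} {g₃ : X₃' ⟶ Y₃'}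
    (hx : x₂ ≫ p' = p ≫ x₃) (hy : y₂ ≫ q' = q ≫ y₃) (hf : f₂ ≫ q = p ≫ f₃)
    (hg : p' ≫ g₃ = g₂ ≫ q') (h₂ : x₂ ≫ g₂ = f₂ ≫ y₂) : x₃ ≫ g₃ = f₃ ≫ y₃ := by
  rw [← cancel_epi p, ← reassoc_of% hx, hg, reassoc_of% h₂, hy, reassoc_of% hf]

variable [Abelian C]

/-- Turns a homotopy into an equation between chain maps, so that a square commuting up to homotopy
can be corrected to commute strictly. -/
theorem sub_eq_nullHomotopicMap {K L : CochainComplex C ℕ} {f g : K ⟶ L} (h : Homotopy f g) :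
    f - g = Homotopy.nullHomotopicMap h.hom := by
  ext i
  rw [HomologicalComplex.sub_f_apply, h.comm i, add_sub_cancel_right]
  rfl

/-- Precomposition with a degreewise monomorphism is surjective on null-homotopic maps to a complex
of injectives. -/
theorem exists_comp_nullHomotopicMap_eq {K L P : CochainComplex C ℕ} (f : K ⟶ L)
    (hf : ∀ i, Mono (f.f i)) (hP : ∀ i, Injective (P.X i)) (h : ∀ i j, K.X i ⟶ P.X j) :
    ∃ h' : ∀ i j, L.X i ⟶ P.X j,
      f ≫ Homotopy.nullHomotopicMap h' = Homotopy.nullHomotopicMap h := by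
  -- A null-homotopic map is built from an arbitrary family of morphisms with no compatibility among
  -- them, so each member can be extended separately.
  refine ⟨fun i j => Injective.factorThru (h i j) (f.f i), ?_⟩
  rw [Homotopy.comp_nullHomotopicMap]
  congr 1
  funext i j
  exact Injective.comp_factorThru _ _

/-- In degree zero a null-homotopic map factors through the differential `K.d 0 1`, which kills the
augmentation. Hence correcting a lift by such a map keeps it a lift. -/
theorem comp_nullHomotopicMap_zero {K L : CochainComplex C ℕ} {X : C} (x : X ⟶ K.X 0)
    (hx : x ≫ K.d 0 1 = 0) (h : ∀ i j, K.X i ⟶ L.X j) :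
    x ≫ (Homotopy.nullHomotopicMap h).f 0 = 0 := by
  rw [Homotopy.nullHomotopicMap_f_of_not_rel_right (c := ComplexShape.up ℕ) (k₀ := 1) (k₁ := 0)
    (zero_add 1) (by simp), reassoc_of% hx, zero_comp]

theorem comp_add_nullHomotopicMap_zero {K L : CochainComplex C ℕ} {X Y : C} {x : X ⟶ K.X 0}
    (hx : x ≫ K.d 0 1 = 0) {χ : K ⟶ L} {f : X ⟶ Y} {y : Y ⟶ L.X 0} (hχ : x ≫ χ.f 0 = f ≫ y)
    (h : ∀ i j, K.X i ⟶ L.X j) :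
    x ≫ (χ + Homotopy.nullHomotopicMap h).f 0 = f ≫ y := by
  rw [HomologicalComplex.add_f_apply, Preadditive.comp_add, hχ, comp_nullHomotopicMap_zero x hx,
    add_zero]

namespace ResolutionSequence

variable {S S' : ShortComplex C} (E : ResolutionSequence S) (E' : ResolutionSequence S')

/-- The underlying short complex of cochain complexes. -/
abbrev complex : ShortComplex (CochainComplex C ℕ) := ShortComplex.mk E.f E.g E.zero

theorem mono_f_f (i : ℕ) : Mono (E.f.f i) :=
  have := E.shortExact.mono_f
  inferInstanceAs (Mono ((HomologicalComplex.eval C (ComplexShape.up ℕ) i).map E.complex.f))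

/-- A morphism of short exact sequences lifts to injective resolutions of them. -/
theorem exists_hom (hS : S.ShortExact) (φ : S ⟶ S') :
    ∃ ψ : E.complex ⟶ E'.complex,
      E.I₁.ι.f 0 ≫ ψ.τ₁.f 0 = φ.τ₁ ≫ E'.I₁.ι.f 0 ∧
      E.I₃.ι.f 0 ≫ ψ.τ₃.f 0 = φ.τ₃ ≫ E'.I₃.ι.f 0 := by
  let ψ₁ := InjectiveResolution.desc φ.τ₁ E'.I₁ E.I₁
  let χ := InjectiveResolution.desc φ.τ₂ E'.I₂ E.I₂
  have hψ₁ : E.I₁.ι.f 0 ≫ ψ₁.f 0 = φ.τ₁ ≫ E'.I₁.ι.f 0 :=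
    InjectiveResolution.desc_commutes_zero φ.τ₁ E'.I₁ E.I₁
  have hχ : E.I₂.ι.f 0 ≫ χ.f 0 = φ.τ₂ ≫ E'.I₂.ι.f 0 :=
    InjectiveResolution.desc_commutes_zero φ.τ₂ E'.I₂ E.I₂
  -- Both sides lift `φ.τ₁ ≫ S'.f = S.f ≫ φ.τ₂` to injective resolutions, so they are homotopic,
  -- though in general not equal.
  have h : Homotopy (ψ₁ ≫ E'.f) (E.f ≫ χ) := by
    refine InjectiveResolution.descHomotopy (φ.τ₁ ≫ S'.f) _ _ ?_ ?_ <;>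
      refine HomologicalComplex.from_single_hom_ext ?_
    · exact (comp_square hψ₁ E'.comm_f).trans
        (congrArg (fun z => z ≫ E'.I₂.ι.f 0) (CochainComplex.single₀_map_f_zero _).symm)
    · refine (comp_square E.comm_f hχ).trans
        (congrArg (fun z => z ≫ E'.I₂.ι.f 0) (.trans ?_ (CochainComplex.single₀_map_f_zero _).symm))
      exact φ.comm₁₂.symm
  obtain ⟨k, hk⟩ := exists_comp_nullHomotopicMap_eq E.f E.mono_f_f E'.I₂.injective h.hom
  -- The homotopy, extended along the degreewise monomorphism `E.f`, is absorbed into the middle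
  -- lift; the left square then commutes strictly.
  let ψ₂ := χ + Homotopy.nullHomotopicMap k
  have h₁₂ : ψ₁ ≫ E'.f = E.f ≫ ψ₂ := by
    rw [Preadditive.comp_add, hk, ← sub_eq_nullHomotopicMap h, add_sub_cancel]
  have hψ₂ : E.I₂.ι.f 0 ≫ ψ₂.f 0 = φ.τ₂ ≫ E'.I₂.ι.f 0 :=
    comp_add_nullHomotopicMap_zero E.I₂.ι_f_zero_comp_complex_d hχ k
  -- The third map is not chosen as a lift of `φ.τ₃` but induced on the cokernel; that it lifts
  -- `φ.τ₃` follows because `S.g` is an epimorphism.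
  obtain ⟨ψ₃, hψ₃⟩ := CokernelCofork.IsColimit.desc' E.shortExact.gIsCokernel (ψ₂ ≫ E'.g)
    (by
      change E.f ≫ ψ₂ ≫ E'.g = 0
      rw [← reassoc_of% h₁₂, E'.zero, comp_zero])
  replace hψ₃ : E.g ≫ ψ₃ = ψ₂ ≫ E'.g := hψ₃
  refine ⟨⟨ψ₁, ψ₂, ψ₃, h₁₂, hψ₃.symm⟩, hψ₁, ?_⟩
  exact descend_square hS.epi_g E.comm_g E'.comm_g φ.comm₂₃
    (congrArg (fun z => HomologicalComplex.Hom.f z 0) hψ₃) hψ₂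

end ResolutionSequence

variable {D : Type u₂} [Category.{v₂} D] [Abelian D] [HasInjectiveResolutions C]

namespace ResolutionSequence

variable {S S' : ShortComplex C} (E : ResolutionSequence S) (E' : ResolutionSequence S')
  (F : C ⥤ D) [F.Additive]

/-- The connecting morphism of the right derived functors computed from a sequence of
injective resolutions. -/
noncomputable def connecting (i : ℕ) :
    (F.rightDerived i).obj S.X₃ ⟶ (F.rightDerived (i + 1)).obj S.X₁ :=
  (E.I₃.isoRightDerivedObj F i).hom ≫ (E.mapComplex_shortExact F).δ i (i + 1) rfl ≫
    (E.I₁.isoRightDerivedObj F (i + 1)).inv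

/-- The lift of `φ` is a morphism of short exact sequences of complexes, for which the connecting
morphism in homology is natural. As `E` and `E'` are arbitrary, the case `φ = 𝟙 S` also shows
independence of the chosen resolutions. -/
theorem connecting_naturality (hS : S.ShortExact) (φ : S ⟶ S') (i : ℕ) :
    E.connecting F i ≫ (F.rightDerived (i + 1)).map φ.τ₁ =
      (F.rightDerived i).map φ.τ₃ ≫ E'.connecting F i := by
  obtain ⟨ψ, h₁, h₃⟩ := E.exists_hom E' hS φ
  have h := HomologicalComplex.HomologySequence.δ_naturality
    ((F.mapHomologicalComplex (ComplexShape.up ℕ)).mapShortComplex.map ψ)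
    (E.mapComplex_shortExact F) (E'.mapComplex_shortExact F) i (i + 1) rfl
  have n₁ := InjectiveResolution.isoRightDerivedObj_inv_naturality φ.τ₁ E.I₁ E'.I₁ ψ.τ₁ h₁ F (i + 1)
  have n₃ := InjectiveResolution.isoRightDerivedObj_hom_naturality φ.τ₃ E.I₃ E'.I₃ ψ.τ₃ h₃ F i
  exact square_of_naturality n₁ n₃ h

end ResolutionSequence

theorem exact_of_exact_of_iso {X Y Z X' Y' Z' : D} {f : X ⟶ Y} {g : Y ⟶ Z} {f' : X' ⟶ Y'}
    {g' : Y' ⟶ Z'} {w' : f' ≫ g' = 0} (h : (ShortComplex.mk f' g' w').Exact) (x : X ≅ X')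
    (y : Y ≅ Y') (z : Z ≅ Z') (hf : x.hom ≫ f' = f ≫ y.hom) (hg : y.hom ≫ g' = g ≫ z.hom) :
    ∃ w : f ≫ g = 0, (ShortComplex.mk f g w).Exact := by
  have w : f ≫ g = 0 := by
    rw [← cancel_mono z.hom, Category.assoc, ← hg, ← reassoc_of% hf, w', comp_zero, zero_comp]
  exact ⟨w, (ShortComplex.exact_iff_of_iso (ShortComplex.isoMk x y z hf hg)).2 h⟩

/-- No differential enters degree zero, so homology there is the object of cycles, on which a
monomorphism of complexes remains a monomorphism. -/
theorem mono_homologyMap_zero {K L : CochainComplex D ℕ} (f : K ⟶ L) [Mono f] :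
    Mono (HomologicalComplex.homologyMap f 0) := by
  have h : K.homologyπ 0 ≫ HomologicalComplex.homologyMap f 0 =
      HomologicalComplex.cyclesMap f 0 ≫ L.homologyπ 0 :=
    HomologicalComplex.homologyπ_naturality f 0
  have := CochainComplex.isIso_homologyπ₀ K
  have := CochainComplex.isIso_homologyπ₀ L
  rw [← IsIso.eq_inv_comp] at h
  rw [h]
  infer_instance

/-- The right derived functors of an additive functor are strongly connected. -/
theorem rightDerivedSequence_isStronglyConnected (F : C ⥤ D) [F.Additive] :
    (rightDerivedSequence F).IsStronglyConnected where
  naturality φ hS hS' i :=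
    (nonempty_resolutionSequence hS).some.connecting_naturality
      (nonempty_resolutionSequence hS').some F hS φ i
  mono S hS := by
    let E : ResolutionSequence S := (nonempty_resolutionSequence hS).some
    have h := InjectiveResolution.isoRightDerivedObj_hom_naturality S.f E.I₁ E.I₂ E.f E.comm_f F 0
    have := (E.mapComplex_shortExact F).mono_f
    have hm : Mono (HomologicalComplex.homologyMap (E.mapComplex F).f 0) := mono_homologyMap_zero _
    have hc := mono_comp' (inferInstance : Mono (E.I₁.isoRightDerivedObj F 0).hom) hm
    exact @mono_of_mono_fac _ _ _ _ _ _ _ _ hc h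
  exact₂ S hS i := by
    let E : ResolutionSequence S := (nonempty_resolutionSequence hS).some
    exact exact_of_exact_of_iso ((E.mapComplex_shortExact F).homology_exact₂ i)
      (E.I₁.isoRightDerivedObj F i) (E.I₂.isoRightDerivedObj F i) (E.I₃.isoRightDerivedObj F i)
      (InjectiveResolution.isoRightDerivedObj_hom_naturality S.f _ _ E.f E.comm_f F i).symm
      (InjectiveResolution.isoRightDerivedObj_hom_naturality S.g _ _ E.g E.comm_g F i).symm
  exact₃ S hS i := by
    let E : ResolutionSequence S := (nonempty_resolutionSequence hS).some
    refine exact_of_exact_of_iso ((E.mapComplex_shortExact F).homology_exact₃ i (i + 1) rfl)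
      (E.I₂.isoRightDerivedObj F i) (E.I₃.isoRightDerivedObj F i)
      (E.I₁.isoRightDerivedObj F (i + 1))
      (InjectiveResolution.isoRightDerivedObj_hom_naturality S.g _ _ E.g E.comm_g F i).symm ?_
    exact (conj_comp_hom _ _ _).symm
  exact₁ S hS i := by
    let E : ResolutionSequence S := (nonempty_resolutionSequence hS).some
    refine exact_of_exact_of_iso ((E.mapComplex_shortExact F).homology_exact₁ i (i + 1) rfl)
      (E.I₃.isoRightDerivedObj F i) (E.I₁.isoRightDerivedObj F (i + 1))
      (E.I₂.isoRightDerivedObj F (i + 1)) (conj_comp_hom _ _ _).symm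
      (InjectiveResolution.isoRightDerivedObj_hom_naturality S.f _ _ E.f E.comm_f F (i + 1)).symm

end DerivedSequences

/-! ### Colimits of sequences of functors and their universal property. -/

namespace FunctorSequence

universe v₁ v₂ u₁ u₂ w w'

variable {C : Type u₁} [Category.{v₁} C] [Abelian C] {D : Type u₂} [Category.{v₂} D]

/-- A morphism of sequences of functors is an isomorphism if all its components are. -/
noncomputable def isoOfIsIsoApp {F G : FunctorSequence C D} (f : F ⟶ G)
    (h : ∀ i X, IsIso ((Hom.app f i).app X)) : F ≅ G :=
  have h' : ∀ i, IsIso (Hom.app f i) := fun i =>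
    have := h i
    NatIso.isIso_of_isIso_app _
  { hom := f
    inv :=
      { app := fun i => inv (Hom.app f i)
        comm := fun S hS i => by
          rw [NatIso.isIso_inv_app, NatIso.isIso_inv_app, IsIso.eq_inv_comp, ← Category.assoc,
            ← f.comm, Category.assoc, IsIso.hom_inv_id, Category.comp_id] }
    hom_inv_id := Hom.ext (funext fun i => IsIso.hom_inv_id (Hom.app f i))
    inv_hom_id := Hom.ext (funext fun i => IsIso.inv_hom_id (Hom.app f i)) }

section Colim

variable {K : Type w} [Category.{w'} K] [HasColimitsOfShape K D]
  (Φ : K ⥤ FunctorSequence C D)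

/-- The evaluation of the colimit cocone of the `i`-th functors at an object. -/
noncomputable abbrev termCocone (i : ℕ) (X : C) :
    Cocone ((Φ ⋙ term i) ⋙ (evaluation C D).obj X) :=
  ((evaluation C D).obj X).mapCocone (colimit.cocone (Φ ⋙ term i))

/-- The evaluated cocone is a colimit cocone. -/
noncomputable def isColimitTermCocone (i : ℕ) (X : C) : IsColimit (termCocone Φ i X) :=
  isColimitOfPreserves _ (colimit.isColimit _)

theorem ι_colim_map (i : ℕ) {X Y : C} (f : X ⟶ Y) (k : K) :
    (termCocone Φ i X).ι.app k ≫ ((colim Φ).T i).map f =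
      ((Φ.obj k).T i).map f ≫ (termCocone Φ i Y).ι.app k :=
  ((colimit.ι (Φ ⋙ term i) k).naturality f).symm

/-- Determines the connecting morphism of the colimit by its restriction to the legs; the
isomorphisms between evaluated colimits and colimits of evaluations play no role afterwards. -/
theorem ι_colim_δ (S : ShortComplex C) (hS : S.ShortExact) (i : ℕ) (k : K) :
    (termCocone Φ i S.X₃).ι.app k ≫ (colim Φ).δ S hS i =
      (Φ.obj k).δ S hS i ≫ (termCocone Φ (i + 1) S.X₁).ι.app k := by
  change (colimit.ι (Φ ⋙ term i) k).app S.X₃ ≫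
    (colimitObjIsoColimitCompEvaluation (Φ ⋙ term i) S.X₃).hom ≫
      colimMap (Functor.whiskerLeft Φ (connecting S hS i)) ≫
        (colimitObjIsoColimitCompEvaluation (Φ ⋙ term (i + 1)) S.X₁).inv =
      (Φ.obj k).δ S hS i ≫ (colimit.ι (Φ ⋙ term (i + 1)) k).app S.X₁
  exact triple_square (colimitObjIsoColimitCompEvaluation_ι_app_hom _ _ _)
    (ι_colimMap (Functor.whiskerLeft Φ (connecting S hS i)) k)
    (colimitObjIsoColimitCompEvaluation_ι_inv (Φ ⋙ term (i + 1)) k S.X₁)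

variable {Φ} in
theorem colim_hom_ext {i : ℕ} {X : C} {Y : D} {f g : ((colim Φ).T i).obj X ⟶ Y}
    (h : ∀ k, (termCocone Φ i X).ι.app k ≫ f = (termCocone Φ i X).ι.app k ≫ g) : f = g :=
  (isColimitTermCocone Φ i X).hom_ext h

/-- The components of the morphism out of a colimit of sequences of functors given by a cocone. -/
noncomputable def colimDescApp {G : FunctorSequence C D} (f : ∀ k, Φ.obj k ⟶ G)
    (hf : ∀ {k l : K} (a : k ⟶ l), Φ.map a ≫ f l = f k) (i : ℕ) : (colim Φ).T i ⟶ G.T i :=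
  colimit.desc (Φ ⋙ term i)
    ⟨G.T i, { app := fun k => Hom.app (f k) i
              naturality := fun _ _ a =>
                (congrArg (fun z => Hom.app z i) (hf a)).trans (Category.comp_id _).symm }⟩

theorem ι_colimDescApp {G : FunctorSequence C D} (f : ∀ k, Φ.obj k ⟶ G)
    (hf : ∀ {k l : K} (a : k ⟶ l), Φ.map a ≫ f l = f k) (i : ℕ) (X : C) (k : K) :
    (termCocone Φ i X).ι.app k ≫ (colimDescApp Φ f hf i).app X = (Hom.app (f k) i).app X :=
  congrArg (fun z => NatTrans.app z X) (colimit.ι_desc (F := Φ ⋙ term i) _ k)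

/-- The morphism out of a colimit of sequences of functors given by a cocone. -/
noncomputable def colimDesc {G : FunctorSequence C D} (f : ∀ k, Φ.obj k ⟶ G)
    (hf : ∀ {k l : K} (a : k ⟶ l), Φ.map a ≫ f l = f k) : colim Φ ⟶ G where
  app := colimDescApp Φ f hf
  comm S hS i := colim_hom_ext fun k =>
    -- The target is constant in `k`, so the edges `y₁` and `y₃` of the cube are identities.
    cube_face (ι_colim_δ Φ S hS i k) ((Category.id_comp _).trans (Category.comp_id _).symm)
      ((ι_colimDescApp Φ f hf (i + 1) S.X₁ k).trans (Category.comp_id _).symm)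
      ((ι_colimDescApp Φ f hf i S.X₃ k).trans (Category.comp_id _).symm) (Hom.comm (f k) S hS i)

end Colim

end FunctorSequence

/-! ### Exactness of diagrams and of their colimits. -/

section Exactness

universe v₂ u₂ w w'

variable {D : Type u₂} [Category.{v₂} D] [Abelian D] {K : Type w} [Category.{w'} K]

/-- Evaluation commutes with homology, and a functor is zero if all its values are. -/
theorem exact_of_exact_evaluation (S : ShortComplex (K ⥤ D))
    (h : ∀ k, (S.map ((evaluation K D).obj k)).Exact) : S.Exact := by
  rw [ShortComplex.exact_iff_isZero_homology]
  refine (Functor.isZero_iff _).2 fun k => ?_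
  have := (ShortComplex.exact_iff_isZero_homology _).1 (h k)
  exact this.of_iso (S.mapHomologyIso ((evaluation K D).obj k)).symm

/-- Exactness of colimits, for arbitrary colimit cocones. -/
theorem exact_of_isColimit [HasColimitsOfShape K D] [HasExactColimitsOfShape K D]
    {F₁ F₂ F₃ : K ⥤ D} {c₁ : Cocone F₁} {c₂ : Cocone F₂} {c₃ : Cocone F₃} (hc₁ : IsColimit c₁)
    (hc₂ : IsColimit c₂) (hc₃ : IsColimit c₃) (α : F₁ ⟶ F₂) (β : F₂ ⟶ F₃)
    (h : ∀ k, ∃ w : α.app k ≫ β.app k = 0, (ShortComplex.mk _ _ w).Exact)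
    (f : c₁.pt ⟶ c₂.pt) (g : c₂.pt ⟶ c₃.pt)
    (hf : ∀ k, c₁.ι.app k ≫ f = α.app k ≫ c₂.ι.app k)
    (hg : ∀ k, c₂.ι.app k ≫ g = β.app k ≫ c₃.ι.app k) :
    ∃ w : f ≫ g = 0, (ShortComplex.mk f g w).Exact := by
  have w : α ≫ β = 0 := NatTrans.ext (funext fun k => (h k).1)
  have hex : (ShortComplex.mk α β w).Exact :=
    exact_of_exact_evaluation _ fun k => (h k).2
  exact ⟨_, colim.exact_mapShortComplex hex hc₁ hc₂ hc₃ f g hf hg⟩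

end Exactness

/-! ### Strong connectedness of exact colimits, and dimension shifting. -/

namespace FunctorSequence

universe v₁ v₂ u₁ u₂ w w'

variable {C : Type u₁} [Category.{v₁} C] [Abelian C] {D : Type u₂} [Category.{v₂} D] [Abelian D]

/-- An exact colimit of strongly connected sequences is strongly connected. -/
theorem colim_isStronglyConnected {K : Type w} [Category.{w'} K] [HasColimitsOfShape K D]
    [HasExactColimitsOfShape K D] (Φ : K ⥤ FunctorSequence C D)
    (h : ∀ k, (Φ.obj k).IsStronglyConnected) : (colim Φ).IsStronglyConnected where
  naturality φ hS hS' i := by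
    refine colim_hom_ext fun k => ?_
    exact cube_face (ι_colim_δ Φ _ hS i k) (ι_colim_δ Φ _ hS' i k) (ι_colim_map Φ (i + 1) φ.τ₁ k)
      (ι_colim_map Φ i φ.τ₃ k) ((h k).naturality φ hS hS' i)
  mono S hS := by
    let α : (Φ ⋙ term 0) ⋙ (evaluation C D).obj S.X₁ ⟶ (Φ ⋙ term 0) ⋙ (evaluation C D).obj S.X₂ :=
      Functor.whiskerLeft (Φ ⋙ term 0) ((evaluation C D).map S.f)
    have : ∀ k, Mono (α.app k) := fun k => (h k).mono S hS
    have : Mono α := NatTrans.mono_of_mono_app α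
    exact colim.map_mono' α (isColimitTermCocone Φ 0 S.X₁) (isColimitTermCocone Φ 0 S.X₂) _
      (ι_colim_map Φ 0 S.f)
  exact₂ S hS i :=
    exact_of_isColimit (isColimitTermCocone Φ i S.X₁) (isColimitTermCocone Φ i S.X₂)
      (isColimitTermCocone Φ i S.X₃)
      (Functor.whiskerLeft (Φ ⋙ term i) ((evaluation C D).map S.f))
      (Functor.whiskerLeft (Φ ⋙ term i) ((evaluation C D).map S.g))
      (fun k => (h k).exact₂ S hS i) _ _ (ι_colim_map Φ i S.f) (ι_colim_map Φ i S.g)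
  exact₃ S hS i :=
    exact_of_isColimit (isColimitTermCocone Φ i S.X₂) (isColimitTermCocone Φ i S.X₃)
      (isColimitTermCocone Φ (i + 1) S.X₁)
      (Functor.whiskerLeft (Φ ⋙ term i) ((evaluation C D).map S.g))
      (Functor.whiskerLeft Φ (connecting S hS i))
      (fun k => (h k).exact₃ S hS i) _ _ (ι_colim_map Φ i S.g) (ι_colim_δ Φ S hS i)
  exact₁ S hS i :=
    exact_of_isColimit (isColimitTermCocone Φ i S.X₃) (isColimitTermCocone Φ (i + 1) S.X₁)
      (isColimitTermCocone Φ (i + 1) S.X₂)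
      (Functor.whiskerLeft Φ (connecting S hS i))
      (Functor.whiskerLeft (Φ ⋙ term (i + 1)) ((evaluation C D).map S.f))
      (fun k => (h k).exact₁ S hS i) _ _ (ι_colim_δ Φ S hS i) (ι_colim_map Φ (i + 1) S.f)

/-- A morphism of strongly connected sequences which vanish on injective objects in positive degrees
is an isomorphism if it is one in degree zero on injective objects. -/
theorem isIso_app_of_injective [EnoughInjectives C] {F G : FunctorSequence C D}
    (hF : F.IsStronglyConnected) (hG : G.IsStronglyConnected)
    (hF₀ : ∀ (i : ℕ) (X : C), Injective X → IsZero ((F.T (i + 1)).obj X))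
    (hG₀ : ∀ (i : ℕ) (X : C), Injective X → IsZero ((G.T (i + 1)).obj X)) (f : F ⟶ G)
    (hf : ∀ X : C, Injective X → IsIso ((Hom.app f 0).app X)) (i : ℕ) (X : C) :
    IsIso ((Hom.app f i).app X) := by
  induction i generalizing X with
  | zero =>
    -- Embed `X` into an injective: `F.T 0` preserves this monomorphism and `f` is invertible on the
    -- injective. The result is needed for all objects, since it is applied to the cokernel of the
    -- embedding below.
    have hmono : ∀ X : C, Mono ((Hom.app f 0).app X) := by
      intro X
      let P := (EnoughInjectives.presentation X).some
      have := hf P.J P.injective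
      have := hF.mono _ P.shortExact_shortComplex
      have n := (Hom.app f 0).naturality P.shortComplex.f
      have : Mono ((F.T 0).map P.shortComplex.f ≫ (Hom.app f 0).app P.shortComplex.X₂) :=
        mono_comp' this (inferInstanceAs (Mono ((Hom.app f 0).app P.J)))
      exact mono_of_mono_fac n.symm
    let P := (EnoughInjectives.presentation X).some
    obtain ⟨w, e⟩ := hF.exact₂ _ P.shortExact_shortComplex 0
    obtain ⟨w', e'⟩ := hG.exact₂ _ P.shortExact_shortComplex 0
    have := hf P.J P.injective
    have hm := hmono X
    -- Four lemma for `0 → T⁰(X) → T⁰(J) → T⁰(J/X)`: `f` is epi on `J` and mono on `J/X`.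
    have he : Epi ((Hom.app f 0).app X) :=
      ShortComplex.epi_of_mono_of_epi_of_mono
        (φ := ShortComplex.homMk (S₁ := .mk _ _ w) (S₂ := .mk _ _ w')
          ((Hom.app f 0).app P.shortComplex.X₁) ((Hom.app f 0).app P.shortComplex.X₂)
          ((Hom.app f 0).app P.shortComplex.X₃) ((Hom.app f 0).naturality _).symm
          ((Hom.app f 0).naturality _).symm)
        e (hG.mono _ P.shortExact_shortComplex)
        (inferInstanceAs (Epi ((Hom.app f 0).app P.J))) (hmono _)
    exact isIso_of_mono_of_epi _
  | succ i ih =>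
    let P := (EnoughInjectives.presentation X).some
    have hS := P.shortExact_shortComplex
    obtain ⟨w, e⟩ := hF.exact₃ _ hS i
    obtain ⟨w', e'⟩ := hG.exact₃ _ hS i
    -- Since `Tⁱ⁺¹(J) = 0`, the sequence `Tⁱ(J) → Tⁱ(J/X) → Tⁱ⁺¹(X) → 0` is exact for both `F` and
    -- `G`. The induction hypothesis covers the first two terms, and thus the third.
    have epiδ : ∀ {H : FunctorSequence C D}, H.IsStronglyConnected →
        IsZero ((H.T (i + 1)).obj P.J) → Epi (H.δ _ hS i) := by
      intro H hH h0
      obtain ⟨v, t⟩ := hH.exact₁ _ hS i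
      exact (t.epi_f (h0.eq_of_tgt _ _))
    have hδF := epiδ hF (hF₀ i P.J P.injective)
    have hδG := epiδ hG (hG₀ i P.J P.injective)
    have i₁ := ih P.shortComplex.X₂
    have i₂ := ih P.shortComplex.X₃
    let φ : ShortComplex.mk _ _ w ⟶ ShortComplex.mk _ _ w' :=
      ShortComplex.homMk ((Hom.app f i).app P.shortComplex.X₂) ((Hom.app f i).app P.shortComplex.X₃)
        ((Hom.app f (i + 1)).app P.shortComplex.X₁) ((Hom.app f i).naturality _).symm
        (Hom.comm f _ hS i).symm
    have hm : Mono ((Hom.app f (i + 1)).app X) :=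
      ShortComplex.mono_of_epi_of_epi_of_mono (φ := φ) e' hδF
        (inferInstanceAs (Epi ((Hom.app f i).app P.shortComplex.X₂)))
        (inferInstanceAs (Mono ((Hom.app f i).app P.shortComplex.X₃)))
    have he : Epi ((Hom.app f (i + 1)).app X) := by
      have n := Hom.comm f _ hS i
      have : Epi ((Hom.app f i).app P.shortComplex.X₃ ≫ G.δ _ hS i) := epi_comp' inferInstance hδG
      exact epi_of_epi_fac n
    exact isIso_of_mono_of_epi _

end FunctorSequence

/-! ### Exactness of filtered colimits of graded modules. -/

namespace GrMod

variable {R : Type u} [CommRing R] (𝒜 : ℤ → AddSubgroup R)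

/-- The functor which forgets the grading. -/
def forgetGrading : GrMod 𝒜 ⥤ ModuleCat.{u} R where
  obj M := ModuleCat.of R M.carrier
  map f := ModuleCat.ofHom f.lin

instance : (forgetGrading 𝒜).Faithful where
  map_injective h := Hom.ext (congrArg ModuleCat.Hom.hom h)

instance : (forgetGrading 𝒜).Additive where

instance : (forgetGrading 𝒜).PreservesMonomorphisms where
  preserves f _ := (ModuleCat.mono_iff_injective _).2 (injective_of_mono f)

variable [GradedRing 𝒜]

/-- The right adjoint is the cofree graded module, so forgetting the grading preserves all colimits.
-/
instance : (forgetGrading 𝒜).IsLeftAdjoint :=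
  (Adjunction.adjunctionOfEquivRight (F := forgetGrading 𝒜) (G_obj := fun A => cofree 𝒜 A)
    (fun _ A =>
      { toFun := fun g => cofreeLift g.hom
        invFun := fun f => ModuleCat.ofHom ((cofreeCounit A).comp f.lin)
        left_inv := fun g => ModuleCat.hom_ext (LinearMap.ext (cofreeCounit_lift g.hom))
        right_inv := cofreeLift_counit })
    fun _ _ _ f g => (comp_cofreeLift f g.hom).symm).isLeftAdjoint

/-- Preserving monomorphisms and cokernels is enough for an additive functor between abelian
categories to be exact. -/
instance : PreservesFiniteLimits (forgetGrading 𝒜) :=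
  have := Functor.preservesHomology_of_preservesMonos_and_cokernels (forgetGrading 𝒜)
  (forgetGrading 𝒜).preservesFiniteLimits_of_preservesHomology

instance : (forgetGrading 𝒜).ReflectsIsomorphisms :=
  reflectsIsomorphisms_of_reflectsMonomorphisms_of_reflectsEpimorphisms _

/-- Filtered colimits of modules are exact, and this is inherited along a functor which preserves
colimits and finite limits and reflects isomorphisms. -/
instance hasExactColimitsOfShape (K : Type u) [SmallCategory K] [IsFiltered K] :
    HasExactColimitsOfShape K (GrMod 𝒜) :=
  HasExactColimitsOfShape.domain_of_functor K (forgetGrading 𝒜)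

end GrMod
-- The canonical map from a functor to its zeroth derived functor.
section ZerothDerived

universe v₁ v₂ u₁ u₂

variable {C : Type u₁} [Category.{v₁} C] [Abelian C] {D : Type u₂} [Category.{v₂} D] [Abelian D]

/-- After embedding the cycles into the term of degree zero, this is naturality of `α` at the
augmentation `P.ι.f 0`. -/
theorem toRightDerivedZero'_comp_cyclesMap {F G : C ⥤ D} [F.Additive] [G.Additive] (α : F ⟶ G)
    {X : C} (P : InjectiveResolution X) :
    P.toRightDerivedZero' F ≫ HomologicalComplex.cyclesMap
      ((NatTrans.mapHomologicalComplex α (ComplexShape.up ℕ)).app P.cocomplex) 0 =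
      α.app X ≫ P.toRightDerivedZero' G := by
  rw [← cancel_mono (HomologicalComplex.iCycles _ _), Category.assoc, Category.assoc,
    HomologicalComplex.cyclesMap_i, InjectiveResolution.toRightDerivedZero'_comp_iCycles,
    InjectiveResolution.toRightDerivedZero'_comp_iCycles_assoc]
  exact α.naturality (P.ι.f 0)

/-- This naturality is in the functor rather than in the object. It translates the maps between the
`*H⁰` into the inclusions between torsion submodules. -/
theorem toRightDerivedZero_naturality [HasInjectiveResolutions C] {F G : C ⥤ D} [F.Additive]
    [G.Additive] (α : F ⟶ G) (X : C) :
    F.toRightDerivedZero.app X ≫ (NatTrans.rightDerived α 0).app X =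
      α.app X ≫ G.toRightDerivedZero.app X := by
  have P := injectiveResolution X
  rw [P.toRightDerivedZero_eq F, P.toRightDerivedZero_eq G,
    InjectiveResolution.rightDerived_app_eq α P]
  exact conj_square (P.isoRightDerivedObj F 0) (P.isoRightDerivedObj G 0)
    (toRightDerivedZero'_comp_cyclesMap α P) (HomologicalComplex.homologyπ_naturality _ 0)

end ZerothDerived

/-! ### Gluing morphisms on directed unions of graded submodules. -/

namespace GrMod

variable {R : Type u} [CommRing R] {𝒜 : ℤ → AddSubgroup R} {M P : GrMod 𝒜}

theorem subMap_id_comp_lin {p q : Submodule R M.carrier}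
    (hp : ∀ (n : ℤ) (x : M.carrier), x ∈ p → proj M.deg n x ∈ p)
    (hq : ∀ (n : ℤ) (x : M.carrier), x ∈ q → proj M.deg n x ∈ q) (h : p ≤ q)
    (g : M.sub q hq ⟶ P) {x : M.carrier} (hx : x ∈ p) :
    (subMap (𝟙 M) hp hq h ≫ g).lin (⟨x, hx⟩ : p) = g.lin (⟨x, h hx⟩ : q) := rfl

section Union

variable {κ : Type*} (p : κ → Submodule R M.carrier) {q : Submodule R M.carrier}
  (hp : ∀ (k : κ) (n : ℤ) (x : M.carrier), x ∈ p k → proj M.deg n x ∈ p k)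
  (hq : ∀ (n : ℤ) (x : M.carrier), x ∈ q → proj M.deg n x ∈ q) (hle : ∀ k, p k ≤ q)

/-- Two morphisms on a union of graded submodules agree if they agree on these submodules. -/
theorem sub_hom_ext (hmem : ∀ x ∈ q, ∃ k, x ∈ p k) {f g : M.sub q hq ⟶ P}
    (h : ∀ k, subMap (𝟙 M) (hp k) hq (hle k) ≫ f = subMap (𝟙 M) (hp k) hq (hle k) ≫ g) :
    f = g := by
  refine Hom.ext (LinearMap.ext fun (x : q) => ?_)
  obtain ⟨k, hk⟩ := hmem x.1 x.2
  exact congrArg (fun a => Hom.lin a (⟨x.1, hk⟩ : p k)) (h k)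

/-- Compatible morphisms on a directed family of graded submodules glue to a morphism on their
union. -/
theorem exists_sub_desc [Preorder κ] [IsDirectedOrder κ] (hmono : ∀ {k l}, k ≤ l → p k ≤ p l)
    (hmem : ∀ x ∈ q, ∃ k, x ∈ p k) (g : ∀ k, M.sub (p k) (hp k) ⟶ P)
    (hg : ∀ {k l} (h : k ≤ l), subMap (𝟙 M) (hp k) (hp l) (hmono h) ≫ g l = g k) :
    ∃ f : M.sub q hq ⟶ P, ∀ k, subMap (𝟙 M) (hp k) hq (hle k) ≫ f = g k := by
  let G : ∀ k, p k →ₗ[R] P.carrier := fun k => (g k).lin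
  have hG : ∀ {k l : κ} (h : k ≤ l) (x : M.carrier) (hx : x ∈ p k),
      G l ⟨x, hmono h hx⟩ = G k ⟨x, hx⟩ := fun {k l} h x hx =>
    (subMap_id_comp_lin (hp k) (hp l) (hmono h) (g l) hx).symm.trans
      (congrArg (fun a => Hom.lin a (⟨x, hx⟩ : p k)) (hg h))
  -- The glued map uses a chosen index for each element. By directedness any other index gives the
  -- same value, so additivity can be checked at an index common to both summands.
  choose i hi using fun x : q => hmem x.1 x.2
  have hG' : ∀ (x : q) (k : κ) (hx : x.1 ∈ p k), G (i x) ⟨x, hi x⟩ = G k ⟨x, hx⟩ := by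
    intro x k hx
    obtain ⟨l, h₁, h₂⟩ := exists_ge_ge (i x) k
    rw [← hG h₁, ← hG h₂]
  let F : q →ₗ[R] P.carrier :=
    { toFun := fun x => G (i x) ⟨x, hi x⟩
      map_add' := fun x y => by
        obtain ⟨l, h₁, h₂⟩ := exists_ge_ge (i x) (i y)
        have hx := hmono h₁ (hi x)
        have hy := hmono h₂ (hi y)
        rw [hG' x l hx, hG' y l hy, hG' (x + y) l (add_mem hx hy), ← map_add]
        rfl
      map_smul' := fun r x => by
        rw [hG' (r • x) (i x) (Submodule.smul_mem _ r (hi x)), RingHom.id_apply, ← map_smul]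
        rfl }
  refine ⟨⟨F, fun n x hx => (g (i x)).map_deg n (⟨x.1, hi x⟩ : p _) hx⟩,
    fun k => Hom.ext (LinearMap.ext fun (x : p k) => ?_)⟩
  exact hG' ⟨x.1, hle k x.2⟩ k x.2

end Union

end GrMod

/-! ### The directed set `*W̃(I,J)`, torsion as a union, and the comparison morphism. -/

section WTilde

variable {R : Type u} [CommRing R] {𝒜 : ℤ → AddSubgroup R} [GradedRing 𝒜] {I J : Ideal R}

/-- If `𝔞ᵐ x = 0`, then `Iⁿᵐ ⊆ (𝔞 + J)ᵐ ⊆ 𝔞ᵐ + J ⊆ Ann(x) + J`. -/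
theorem torsion_le_torsion_of_pow_le {𝔞 : Ideal R} {n : ℕ} (h : I ^ n ≤ 𝔞 ⊔ J) (M : Type u)
    [AddCommGroup M] [Module R M] : torsion 𝔞 ⊥ M ≤ torsion I J M := by
  intro x hx
  rw [mem_torsion_iff] at hx ⊢
  obtain ⟨m, hm⟩ := hx
  refine ⟨n * m, ?_⟩
  rw [pow_mul]
  refine (Ideal.pow_right_mono h m).trans ((sup_pow_le 𝔞 J m).trans (sup_le_sup_right ?_ J))
  rwa [sup_bot_eq] at hm

theorem WTilde.nonempty : Nonempty (WTilde 𝒜 I J) :=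
  ⟨⟨⊤, Ideal.IsHomogeneous.top 𝒜, 1, le_rfl, by rw [top_sup_eq]; exact le_top⟩⟩

theorem mul_sup_mul_le (𝔞 𝔟 J : Ideal R) : (𝔞 ⊔ J) * (𝔟 ⊔ J) ≤ 𝔞 * 𝔟 ⊔ J := by
  rw [Ideal.sup_mul, Ideal.mul_sup]
  exact sup_le (sup_le le_sup_left (Ideal.mul_le_right.trans le_sup_right))
    (Ideal.mul_le_left.trans le_sup_right)

/-- The order reverses inclusion, so an upper bound is an ideal contained in both. The product
serves, since `Iⁿ⁺ᵐ ⊆ (𝔞 + J)(𝔟 + J) ⊆ 𝔞𝔟 + J`. -/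
theorem WTilde.isDirectedOrder : IsDirectedOrder (WTilde 𝒜 I J) where
  directed 𝔞 𝔟 := by
    obtain ⟨n, hn, h₁⟩ := 𝔞.2.2
    obtain ⟨m, -, h₂⟩ := 𝔟.2.2
    have h : I ^ (n + m) ≤ 𝔞.1 * 𝔟.1 ⊔ J := by
      rw [pow_add]
      exact (Ideal.mul_mono h₁ h₂).trans (mul_sup_mul_le _ _ _)
    refine ⟨⟨𝔞.1 * 𝔟.1, 𝔞.2.1.mul 𝔟.2.1, n + m, by omega, h⟩, ?_, ?_⟩
    · exact (WTilde.le_iff 𝒜 _ _).2 Ideal.mul_le_left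
    · exact (WTilde.le_iff 𝒜 _ _).2 Ideal.mul_le_right

/-- For `x` of degree `n`, the component of `a • x` in degree `k + n` is `aₖ • x`, so `a • x = 0`
forces every `aₖ • x = 0`. -/
theorem torsionOf_isHomogeneous {M : Type u} [AddCommGroup M] [Module R M]
    (ℳ : ℤ → AddSubgroup M) [DirectSum.Decomposition ℳ] [SetLike.GradedSMul 𝒜 ℳ] {n : ℤ} {x : M}
    (hx : x ∈ ℳ n) : (Ideal.torsionOf R M x).IsHomogeneous 𝒜 := by
  intro k a ha
  rw [Ideal.mem_torsionOf_iff] at ha ⊢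
  change proj 𝒜 k a • x = 0
  obtain ⟨s, hs⟩ := exists_finset_proj 𝒜 a
  have h := congrArg (proj ℳ (k + n)) ha
  rw [map_zero, ← sum_proj_of_subset 𝒜 (s := insert k s) (x := a)
    (fun j hj => hs j fun h => hj (Finset.mem_insert_of_mem h)), Finset.sum_smul, map_sum,
    Finset.sum_eq_single k] at h
  · rwa [proj_smul_of_mem ℳ 𝒜 (proj_mem 𝒜 k a), add_sub_cancel_left, proj_same ℳ hx] at h
  · intro j _ hj
    rw [proj_smul_of_mem ℳ 𝒜 (proj_mem 𝒜 j a), proj_ne ℳ hx (by omega), smul_zero]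
  · intro hk
    exact absurd (Finset.mem_insert_self k s) hk

theorem WTilde.torsion_mono {𝔞 𝔟 : WTilde 𝒜 I J} (h : 𝔞 ≤ 𝔟) (M : Type u) [AddCommGroup M]
    [Module R M] : torsion 𝔞.1 ⊥ M ≤ torsion 𝔟.1 ⊥ M :=
  GradedLC.torsion_mono ((WTilde.le_iff 𝒜 𝔞 𝔟).1 h) le_rfl M

theorem WTilde.torsion_le (𝔞 : WTilde 𝒜 I J) (M : Type u) [AddCommGroup M] [Module R M] :
    torsion 𝔞.1 ⊥ M ≤ torsion I J M :=
  torsion_le_torsion_of_pow_le 𝔞.2.2.choose_spec.2 M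

/-- Every `(I,J)`-torsion element of a graded module is `𝔞`-torsion for some homogeneous ideal `𝔞`
in `*W̃(I,J)`. -/
theorem exists_mem_torsion [IsNoetherianRing R] {M : Type u} [AddCommGroup M] [Module R M]
    (ℳ : ℤ → AddSubgroup M) [DirectSum.Decomposition ℳ] [SetLike.GradedSMul 𝒜 ℳ] {x : M}
    (hx : x ∈ torsion I J M) : ∃ 𝔞 : WTilde 𝒜 I J, x ∈ torsion 𝔞.1 ⊥ M := by
  have h : ∀ n, ∃ 𝔞 : WTilde 𝒜 I J, proj ℳ n x ∈ torsion 𝔞.1 ⊥ M := by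
    intro n
    obtain ⟨k, hk⟩ := (mem_torsion_iff I J _).1 (proj_mem_torsion ℳ 𝒜 I J hx n)
    -- The annihilator of the component is the required ideal: `Iᵏ ⊆ Ann + J` is exactly the
    -- membership condition, with `k` raised to `k + 1` to make the exponent positive.
    refine ⟨⟨Ideal.torsionOf R M (proj ℳ n x), torsionOf_isHomogeneous ℳ (proj_mem ℳ n x), k + 1,
      by omega, (Ideal.pow_le_pow_right k.le_succ).trans hk⟩, (mem_torsion_iff _ _ _).2 ⟨1, ?_⟩⟩
    rw [pow_one]
    exact le_sup_left
  choose 𝔞 h𝔞 using h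
  obtain ⟨s, hs⟩ := exists_sum_proj ℳ x
  classical
  have := WTilde.nonempty (𝒜 := 𝒜) (I := I) (J := J)
  have := WTilde.isDirectedOrder (𝒜 := 𝒜) (I := I) (J := J)
  -- Only finitely many components matter, so one ideal `𝔟` above all of theirs works for the whole
  -- element.
  obtain ⟨𝔟, h𝔟⟩ := (s.image 𝔞).exists_le
  refine ⟨𝔟, ?_⟩
  rw [← hs]
  exact sum_mem fun n hn => WTilde.torsion_mono (h𝔟 _ (Finset.mem_image_of_mem 𝔞 hn)) M (h𝔞 n)

variable (𝒜 I J) [IsNoetherianRing R]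

namespace WTilde

variable {𝒜 I J}

/-- The inclusion `Γ_𝔞(M) ⊆ Γ_{I,J}(M)` for `𝔞` in `*W̃(I,J)`. -/
noncomputable def inclusion (𝔞 : WTilde 𝒜 I J) :
    GrMod.torsionFunctor (𝒜 := 𝒜) 𝔞.1 ⊥ ⟶ GrMod.torsionFunctor I J where
  app M := GrMod.subMap (𝟙 M) (fun n _ hx => proj_mem_torsion M.deg 𝒜 𝔞.1 ⊥ hx n)
    (fun n _ hx => proj_mem_torsion M.deg 𝒜 I J hx n) (𝔞.torsion_le M.carrier)
  naturality M N f := by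
    refine (GrMod.subMap_comp f (𝟙 N) _ _ _ _ _ ?_).symm.trans ?_
    · intro x hx
      exact 𝔞.torsion_le _ (map_mem_torsion 𝔞.1 ⊥ f.lin hx)
    · exact GrMod.subMap_comp (𝟙 M) f _ _ _ _ _ _

/-- The inclusion `Γ_𝔞(M) ⊆ Γ_𝔟(M)` for `𝔞 ≤ 𝔟` in `*W̃(I,J)`. -/
noncomputable abbrev transition {𝔞 𝔟 : WTilde 𝒜 I J} (h : 𝔞 ≤ 𝔟) :
    GrMod.torsionFunctor (𝒜 := 𝒜) 𝔞.1 ⊥ ⟶ GrMod.torsionFunctor 𝔟.1 ⊥ :=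
  GrMod.torsionInclusion ((WTilde.le_iff 𝒜 𝔞 𝔟).1 h) ⊥

theorem transition_comp_inclusion {𝔞 𝔟 : WTilde 𝒜 I J} (h : 𝔞 ≤ 𝔟) :
    transition h ≫ 𝔟.inclusion = 𝔞.inclusion :=
  NatTrans.ext (funext fun M => (GrMod.subMap_comp (𝟙 M) (𝟙 M) _ _ _ _ _ _).symm)

/-- The cocone condition needed to define the comparison morphism. -/
theorem map_comp_inclusion {𝔞 𝔟 : WTilde 𝒜 I J} (a : 𝔞 ⟶ 𝔟) :
    (localCohomologySystem 𝒜 I J).map a ≫ rightDerivedSequenceMap 𝔟.inclusion =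
      rightDerivedSequenceMap 𝔞.inclusion :=
  (rightDerivedSequenceMap_comp (F := GrMod.torsionFunctor 𝔞.1 ⊥)
    (G := GrMod.torsionFunctor 𝔟.1 ⊥) (transition (leOfHom a)) 𝔟.inclusion).symm.trans
    (congrArg (fun α => rightDerivedSequenceMap (F := GrMod.torsionFunctor 𝔞.1 ⊥)
      (G := GrMod.torsionFunctor I J) α) (transition_comp_inclusion (leOfHom a)))

variable {M P : GrMod 𝒜}

/-- Together with `exists_torsion_desc`, this says that `Γ_{I,J}(M)` is the colimit of the `Γ_𝔞(M)`.
-/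
theorem torsion_hom_ext {f g : (GrMod.torsionFunctor I J).obj M ⟶ P}
    (h : ∀ 𝔞 : WTilde 𝒜 I J, 𝔞.inclusion.app M ≫ f = 𝔞.inclusion.app M ≫ g) : f = g :=
  GrMod.sub_hom_ext (fun 𝔞 : WTilde 𝒜 I J => torsion 𝔞.1 ⊥ M.carrier)
    (fun 𝔞 n _ hx => proj_mem_torsion M.deg 𝒜 𝔞.1 ⊥ hx n)
    (fun n _ hx => proj_mem_torsion M.deg 𝒜 I J hx n) (fun 𝔞 => 𝔞.torsion_le M.carrier)
    (fun _ => exists_mem_torsion M.deg) h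

/-- Compatible morphisms on the submodules `Γ_𝔞(M)` glue to a morphism on their union
`Γ_{I,J}(M)`. -/
theorem exists_torsion_desc
    (g : ∀ 𝔞 : WTilde 𝒜 I J, (GrMod.torsionFunctor 𝔞.1 ⊥).obj M ⟶ P)
    (hg : ∀ {𝔞 𝔟 : WTilde 𝒜 I J} (h : 𝔞 ≤ 𝔟), (transition h).app M ≫ g 𝔟 = g 𝔞) :
    ∃ f : (GrMod.torsionFunctor I J).obj M ⟶ P,
      ∀ 𝔞 : WTilde 𝒜 I J, 𝔞.inclusion.app M ≫ f = g 𝔞 :=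
  have := isDirectedOrder (𝒜 := 𝒜) (I := I) (J := J)
  GrMod.exists_sub_desc (fun 𝔞 : WTilde 𝒜 I J => torsion 𝔞.1 ⊥ M.carrier)
    (fun 𝔞 n _ hx => proj_mem_torsion M.deg 𝒜 𝔞.1 ⊥ hx n)
    (fun n _ hx => proj_mem_torsion M.deg 𝒜 I J hx n) (fun 𝔞 => 𝔞.torsion_le M.carrier)
    (fun h => torsion_mono h M.carrier) (fun _ => exists_mem_torsion M.deg) g hg

end WTilde

/-- The comparison morphism from the colimit of the sequences `(*Hⁱ_𝔞)ᵢ` to `(*Hⁱ_{I,J})ᵢ`. -/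
noncomputable def comparison :
    FunctorSequence.colim (localCohomologySystem 𝒜 I J) ⟶ gradedLocalCohomology 𝒜 I J :=
  FunctorSequence.colimDesc (localCohomologySystem 𝒜 I J)
    (fun 𝔞 => rightDerivedSequenceMap 𝔞.inclusion) (WTilde.map_comp_inclusion)

/-- In degree zero, the comparison morphism is an isomorphism on injective objects. -/
theorem isIso_comparison_zero (E : GrMod 𝒜) (hE : Injective E) :
    IsIso ((FunctorSequence.Hom.app (comparison 𝒜 I J) 0).app E) := by
  let Φ := localCohomologySystem 𝒜 I J
  let c : Cocone ((Φ ⋙ FunctorSequence.term 0) ⋙ (evaluation _ _).obj E) := FunctorSequence.termCocone Φ 0 E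
  let t : ∀ 𝔞 : WTilde 𝒜 I J, (GrMod.torsionFunctor 𝔞.1 ⊥).obj E ⟶ _ := fun 𝔞 =>
    (GrMod.torsionFunctor 𝔞.1 ⊥).toRightDerivedZero.app E
  let T := (GrMod.torsionFunctor (𝒜 := 𝒜) I J).toRightDerivedZero.app E
  let f : c.pt ⟶ ((GrMod.torsionFunctor I J).rightDerived 0).obj E :=
    (FunctorSequence.Hom.app (comparison 𝒜 I J) 0).app E
  have hf : ∀ 𝔞 : WTilde 𝒜 I J,
      c.ι.app 𝔞 ≫ f = (NatTrans.rightDerived 𝔞.inclusion 0).app E := fun 𝔞 =>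
    FunctorSequence.ι_colimDescApp Φ (fun 𝔞 => rightDerivedSequenceMap 𝔞.inclusion)
      WTilde.map_comp_inclusion 0 E 𝔞
  have hT : ∀ 𝔞 : WTilde 𝒜 I J,
      t 𝔞 ≫ (NatTrans.rightDerived 𝔞.inclusion 0).app E = 𝔞.inclusion.app E ≫ T := fun 𝔞 =>
    toRightDerivedZero_naturality 𝔞.inclusion E
  -- The inverse direction: the maps `Γ_𝔞(E) → *H⁰_𝔞(E) → colim *H⁰_𝔟(E)` agree on smaller torsion
  -- submodules and glue to a map on `Γ_{I,J}(E)`.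
  obtain ⟨d, hd⟩ := WTilde.exists_torsion_desc (M := E) (P := c.pt)
    (fun 𝔞 : WTilde 𝒜 I J => t 𝔞 ≫ c.ι.app 𝔞) (fun {𝔞 𝔟} h => by
      have h₁ : t 𝔞 ≫ (NatTrans.rightDerived (WTilde.transition h) 0).app E =
        (WTilde.transition h).app E ≫ t 𝔟 := toRightDerivedZero_naturality (WTilde.transition h) E
      have h₂ : (NatTrans.rightDerived (WTilde.transition h) 0).app E ≫ c.ι.app 𝔟 = c.ι.app 𝔞 :=
        c.w (homOfLE h)
      exact comp_eq_of_square h₁ h₂)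
  -- Injectivity of `E` enters here and for `T`: on injectives the map to the zeroth derived functor
  -- is invertible, without appeal to left exactness.
  have ht : ∀ 𝔞, IsIso (t 𝔞) := fun 𝔞 =>
    inferInstanceAs (IsIso ((GrMod.torsionFunctor 𝔞.1 ⊥).toRightDerivedZero.app E))
  have hTi : IsIso T :=
    inferInstanceAs (IsIso ((GrMod.torsionFunctor (𝒜 := 𝒜) I J).toRightDerivedZero.app E))
  exact isIso_of_glue (f := f) ht hTi hf hT hd WTilde.torsion_hom_ext
    (FunctorSequence.colim_hom_ext (Φ := Φ) (i := 0) (X := E))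

theorem isZero_gradedLocalCohomology (i : ℕ) (E : GrMod 𝒜) (hE : Injective E) :
    IsZero (((gradedLocalCohomology 𝒜 I J).T (i + 1)).obj E) :=
  (GrMod.torsionFunctor I J).isZero_rightDerived_obj_injective_succ i E

/-- The identity of a colimit is determined on the legs, and here these start from zero objects. -/
theorem isZero_colim_localCohomologySystem (i : ℕ) (E : GrMod 𝒜) (hE : Injective E) :
    IsZero (((FunctorSequence.colim (localCohomologySystem 𝒜 I J)).T (i + 1)).obj E) :=
  (IsZero.iff_id_eq_zero _).2 <| FunctorSequence.colim_hom_ext fun 𝔞 =>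
    (isZero_gradedLocalCohomology 𝒜 𝔞.1 ⊥ i E hE).eq_of_src _ _

theorem gradedLocalCohomology_isStronglyConnected :
    (gradedLocalCohomology 𝒜 I J).IsStronglyConnected :=
  rightDerivedSequence_isStronglyConnected _

theorem colim_localCohomologySystem_isStronglyConnected :
    (FunctorSequence.colim (localCohomologySystem 𝒜 I J)).IsStronglyConnected :=
  -- A nonempty directed order is a filtered category, so colimits over it are exact.
  have := WTilde.nonempty (𝒜 := 𝒜) (I := I) (J := J)
  have := WTilde.isDirectedOrder (𝒜 := 𝒜) (I := I) (J := J)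
  FunctorSequence.colim_isStronglyConnected _ fun 𝔞 =>
    gradedLocalCohomology_isStronglyConnected 𝒜 𝔞.1 ⊥

/-- The sequence `(*Hⁱ_{I,J})ᵢ` is the colimit of the sequences `(*Hⁱ_𝔞)ᵢ`. -/
noncomputable def colimIsoGradedLocalCohomology :
    FunctorSequence.colim (localCohomologySystem 𝒜 I J) ≅ gradedLocalCohomology 𝒜 I J :=
  FunctorSequence.isoOfIsIsoApp (comparison 𝒜 I J) <| FunctorSequence.isIso_app_of_injective
    (colim_localCohomologySystem_isStronglyConnected 𝒜 I J)
    (gradedLocalCohomology_isStronglyConnected 𝒜 I J)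
    (isZero_colim_localCohomologySystem 𝒜 I J) (isZero_gradedLocalCohomology 𝒜 I J) _
    (isIso_comparison_zero 𝒜 I J)

end WTilde

end GradedLC

theorem proposition2p4 {R : Type u} [CommRing R] [IsNoetherianRing R]
    (𝒜 : ℤ → AddSubgroup R) [GradedRing 𝒜] (I J : Ideal R)
    (hI : I.IsHomogeneous 𝒜) (hJ : J.IsHomogeneous 𝒜) :
    (∀ M : GradedLC.GrMod 𝒜, (GradedLC.torsion I J M.carrier).IsHomogeneous M.deg) ∧
      (GradedLC.gradedLocalCohomology 𝒜 I J).IsStronglyConnected ∧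
      (GradedLC.FunctorSequence.colim
        (GradedLC.localCohomologySystem 𝒜 I J)).IsStronglyConnected ∧
      Nonempty (GradedLC.gradedLocalCohomology 𝒜 I J ≅
        GradedLC.FunctorSequence.colim (GradedLC.localCohomologySystem 𝒜 I J)) :=
  ⟨fun M n _ hx => GradedLC.proj_mem_torsion M.deg 𝒜 I J hx n,
    GradedLC.gradedLocalCohomology_isStronglyConnected 𝒜 I J,
    GradedLC.colim_localCohomologySystem_isStronglyConnected 𝒜 I J,
    ⟨(GradedLC.colimIsoGradedLocalCohomology 𝒜 I J).symm⟩⟩
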